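/- **Conventions.** "Computable" means computable by Kleene's schemes S1–S9. The objects of type $0$ are the natural numbers, those of type $1$ are the functions $\mathbb{N}\to\mathbb{N}$, those of type $2$ are the maps $\mathbb{N}^{\mathbb{N}}\to\mathbb{N}$; objects of type $1\to 1$ and $(1\to 1)\to 1$ are coded in the usual way as objects of pure type $2$ and $3$. Real numbers are represented by elements of $\mathbb{N}^{\mathbb{N}}$ that code fast converging sequences of rationals, $|q_n-q_{n+i}|<2^{-n}$ for all $n,i$ (sequences that are not fast converging are made so by a fixed truncation, so that each element of $\mathbb{N}^{\mathbb{N}}$ represents a real). A function $[0,1]\to\mathbb{R}$ is represented by an object of type $1\to 1$ that sends each representation of $x\in[0,1]$ to a representation of the value at $x$. The functional $\exists^2$ is given by $\exists^2(f)=0$ if $f(n)=0$ for some $n$, and $\exists^2(f)=1$ otherwise. Let $O\subseteq[0,1]$ be (relatively) open. A function $Y:[0,1]\to[0,1]$ represents $O$ as in (R.2) if $O=\{x\in[0,1] : Y(x)>0\}$ and if $Y(x)>0$ implies $(x-Y(x),x+Y(x))\cap[0,1]\subseteq O$. A continuous function $D:[0,1]\to\mathbb{R}$ represents $O$ as in (R.3)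 if $D(x)$ is the distance from $x$ to $[0,1]\setminus O$ for all $x \in [0,1]$ when $O\neq[0,1]$, and $D$ is constant $1$ when $O=[0,1]$. A $\Delta$-functional is a functional $\Delta:(1\to 1)\to(1\to 1)$ such that, whenever $Y$ represents an open set $O$ as in (R.2), $\Delta(Y)$ represents the same $O$ as in (R.3). (On such $Y$, the real function represented by $\Delta(Y)$ is uniquely determined.) A Pincherle realiser is a functional $M:(1\to 1)\to 1$ such that for every (representation of a) function $Y:[0,1]\to\mathbb{R}^+$ the real number $M(Y)$ is positive and is a lower bound of every $Z:[0,1]\to\mathbb{R}$ that satisfies $$\forall x,y\in[0,1]\;\bigl(|x-y|<Y(x)\rightarrow Z(y)>Y(x)\bigr).$$ **Theorem 7.5 (with Lemma 7.3).** 1. There is a single index $e$ such that for every Pincherle realiser $M$, the algorithm $e$ computes a $\Delta$-functional from $M$ and $\exists^2$: there is a $\Delta$-functional $\Delta$ with $\{e\}(k,f,Y,\exists^2,M)=\Delta(Y)(f)(k)$ for all $Y$ of type $1\to 1$, all $f\in\mathbb{N}^{\mathbb{N}}$ and all $k\in\mathbb{N}$. 2. No $\Delta$-functional is computable in a functional of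 type $2$: for each $F:\mathbb{N}^{\mathbb{N}}\to\mathbb{N}$ and each $\Delta$-functional $\Delta$, there is no index $e$ such that $\{e\}(k,f,Y,F)=\Delta(Y)(f)(k)$ for all $Y$ that represent an open set as in (R.2), all $f$ that represent a real in $[0,1]$, and all $k\in\mathbb{N}$. -/

import Mathlib

namespace KleeneHigher

open Filter Topology

/-! ### Kleene's schemes S1-S9 over the full pure type structure -/

/-- The pure types: type `0` is `ℕ`, type `n + 1` consists of all total maps from type `n`
to `ℕ`. -/
def PureType : ℕ → Type
  | 0 => ℕ
  | n + 1 => PureType n → ℕ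

/-- An argument of a computation: an object of some pure type. -/
abbrev Arg : Type := Σ j : ℕ, PureType j

/-- A number as an argument of type 0. -/
def arg0 (n : ℕ) : Arg := ⟨0, n⟩

/-- A function as an argument of type 1. -/
def arg1 (f : ℕ → ℕ) : Arg := ⟨1, f⟩

/-- A functional as an argument of type 2. -/
def arg2 (F : (ℕ → ℕ) → ℕ) : Arg := ⟨2, F⟩

/-- A functional as an argument of type 3. -/
def arg3 (Φ : ((ℕ → ℕ) → ℕ) → ℕ) : Arg := ⟨3, Φ⟩

/-- The index with scheme number `s` and parameters `a` and `b`. -/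
def idx (s a b : ℕ) : ℕ := Nat.pair s (Nat.pair a b)

/-- `Kleene e l m` says that `{e}(l)` is defined with value `m`: the least relation closed under
Kleene's schemes S1-S9. Arguments of all types are kept in one list `l`. -/
inductive Kleene : ℕ → List Arg → ℕ → Prop
  /-- S1: `φ(x, l) = x + 1`. -/
  | s1 (x : ℕ) (l : List Arg) : Kleene (idx 1 0 0) (arg0 x :: l) (x + 1)
  /-- S2: `φ(l) = q`. -/
  | s2 (q : ℕ) (l : List Arg) : Kleene (idx 2 q 0) l q
  /-- S3: `φ(x, l) = x`. -/
  | s3 (x : ℕ) (l : List Arg) : Kleene (idx 3 0 0) (arg0 x :: l) x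
  /-- S4: `φ(l) = ψ(χ(l), l)`. -/
  | s4 {g h : ℕ} {l : List Arg} {n m : ℕ} :
      Kleene h l n → Kleene g (arg0 n :: l) m → Kleene (idx 4 g h) l m
  /-- S5, primitive recursion: `φ(0, l) = ψ(l)`. -/
  | s5_zero {g h : ℕ} {l : List Arg} {m : ℕ} :
      Kleene g l m → Kleene (idx 5 g h) (arg0 0 :: l) m
  /-- S5, primitive recursion: `φ(x + 1, l) = χ(x, φ(x, l), l)`. -/
  | s5_succ {g h x : ℕ} {l : List Arg} {n m : ℕ} :
      Kleene (idx 5 g h) (arg0 x :: l) n → Kleene h (arg0 x :: arg0 n :: l) m →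
      Kleene (idx 5 g h) (arg0 (x + 1) :: l) m
  /-- S6: `φ(l) = ψ(l')`, where `l'` arises from `l` by moving one argument to the front. -/
  | s6 {g : ℕ} {a : Arg} {l₁ l₂ : List Arg} {m : ℕ} :
      Kleene g (a :: (l₁ ++ l₂)) m → Kleene (idx 6 l₁.length g) (l₁ ++ a :: l₂) m
  /-- S7: `φ(f, x, l) = f(x)`. -/
  | s7 (f : ℕ → ℕ) (x : ℕ) (l : List Arg) : Kleene (idx 7 0 0) (arg1 f :: arg0 x :: l) (f x)
  /-- S8: `φ(α, l) = α(λ β. χ(α, β, l))` for `α` of type `j + 2` and `β` ranging over type `j`;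
  it is defined only if `χ(α, β, l)` is defined for all `β`. -/
  | s8 {g j : ℕ} (α : PureType (j + 2)) {l : List Arg} {G : PureType (j + 1)} :
      (∀ β : PureType j, Kleene g (⟨j + 2, α⟩ :: ⟨j, β⟩ :: l) (G β)) →
      Kleene (idx 8 j g) (⟨j + 2, α⟩ :: l) (α G)
  /-- S9: `φ(a, l₁, l₂) = {a}(l₁)`. -/
  | s9 {a : ℕ} {l₁ l₂ : List Arg} {m : ℕ} :
      Kleene a l₁ m → Kleene (idx 9 l₁.length 0) (arg0 a :: (l₁ ++ l₂)) m

open Classical in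
/-- The functional `∃²`: `∃²(f) = 0` if `f` has a zero, and `∃²(f) = 1` otherwise. -/
noncomputable def existsTwo (f : ℕ → ℕ) : ℕ := if ∃ n, f n = 0 then 0 else 1

/-! ### Representations of real numbers and of real functions -/

/-- The rational number with code `n`. -/
def ratOf (n : ℕ) : ℚ :=
  ((n.unpair.1 : ℚ) - (n.unpair.2.unpair.1 : ℚ)) / ((n.unpair.2.unpair.2 : ℚ) + 1)

/-- The initial segment `q 0, …, q m` is fast converging. -/
def FastUpTo (q : ℕ → ℚ) (m : ℕ) : Prop :=
  ∀ j ≤ m, ∀ i ≤ j, |q i - q j| < (1 / 2) ^ i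

instance (q : ℕ → ℚ) : DecidablePred (FastUpTo q) := fun m => by
  unfold FastUpTo; infer_instance

/-- The 'hat' of a sequence of rationals: it equals the sequence as long as this is fast
converging, that is `|q i - q (i + k)| < 2⁻ⁱ`, and is constant from then on. -/
def hat (q : ℕ → ℚ) (n : ℕ) : ℚ := q (Nat.findGreatest (FastUpTo q) n)

/-- The real number represented by `f`. Every `f` represents a real number. -/
noncomputable def realOf (f : ℕ → ℕ) : ℝ :=
  limUnder atTop fun n => ((hat (fun k => ratOf (f k)) n : ℚ) : ℝ)

theorem hat_fast (q : ℕ → ℚ) {i j : ℕ} (h : i ≤ j) : |hat q i - hat q j| < (1 / 2) ^ i := by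
  have h0 : FastUpTo q 0 := by
    intro j hj i hi
    obtain rfl : j = 0 := by omega
    obtain rfl : i = 0 := by omega
    simp
  have hj := Nat.findGreatest_spec (P := FastUpTo q) (Nat.zero_le j) h0
  unfold hat
  by_cases hi : i ≤ Nat.findGreatest (FastUpTo q) j
  · have hi' : FastUpTo q i := fun b hb a ha => hj b (hb.trans hi) a ha
    have e : Nat.findGreatest (FastUpTo q) i = i :=
      le_antisymm (Nat.findGreatest_le i) (Nat.le_findGreatest le_rfl hi')
    rw [e]
    exact hj _ le_rfl _ hi
  · have e : Nat.findGreatest (FastUpTo q) i = Nat.findGreatest (FastUpTo q) j :=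
      le_antisymm (Nat.findGreatest_mono_right _ h)
        (Nat.le_findGreatest (by omega) hj)
    rw [e]
    simp

/-- The representing sequence, after 'hat', converges to `realOf f`. -/
theorem tendsto_realOf (f : ℕ → ℕ) :
    Tendsto (fun n => ((hat (fun k => ratOf (f k)) n : ℚ) : ℝ)) atTop (𝓝 (realOf f)) := by
  refine CauchySeq.tendsto_limUnder ?_
  refine cauchySeq_of_le_tendsto_0 (fun n => 2 * (1 / 2 : ℝ) ^ n) ?_ ?_
  · intro n m N hn hm
    have key : ∀ k, N ≤ k → |((hat (fun k => ratOf (f k)) N : ℚ) : ℝ)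
        - ((hat (fun k => ratOf (f k)) k : ℚ) : ℝ)| ≤ (1 / 2) ^ N := by
      intro k hk
      have := (hat_fast (fun k => ratOf (f k)) hk).le
      have h2 := (Rat.cast_le (K := ℝ)).2 this
      push_cast at h2
      exact h2
    calc dist _ _ ≤ _ := dist_triangle_left _ _ ((hat (fun k => ratOf (f k)) N : ℚ) : ℝ)
      _ ≤ (1 / 2) ^ N + (1 / 2) ^ N := add_le_add (key n hn) (key m hm)
      _ = _ := by ring
  · simpa using (tendsto_pow_atTop_nhds_zero_of_lt_one (r := (1 / 2 : ℝ))
      (by norm_num) (by norm_num)).const_mul 2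

/-- Objects of type `1 → 1`, used to represent real functions. -/
abbrev FunCode : Type := (ℕ → ℕ) → (ℕ → ℕ)

/-- `Y` represents the function `y : [0, 1] → ℝ`. In particular `Y` is extensional on the reals in
`[0, 1]`. -/
def Represents (Y : FunCode) (y : unitInterval → ℝ) : Prop :=
  ∀ (f : ℕ → ℕ) (hf : realOf f ∈ unitInterval), realOf (Y f) = y ⟨realOf f, hf⟩

/-- (R.2): `Y` represents a function `y : [0, 1] → [0, 1]` that is positive exactly on `O` and that
gives, at each point where it is positive, a radius of a neighbourhood inside `O`. -/
def RadiusRep (Y : FunCode) (O : Set unitInterval) : Prop :=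
  ∃ y : unitInterval → unitInterval, Represents Y (fun x => (y x : ℝ)) ∧
    O = {x | 0 < (y x : ℝ)} ∧
    ∀ x, 0 < (y x : ℝ) → ∀ z : unitInterval,
      (z : ℝ) ∈ Set.Ioo ((x : ℝ) - y x) ((x : ℝ) + y x) → z ∈ O

/-- (R.3): `D` represents a continuous function on `[0, 1]` that is the distance to the complement
of `O` if this complement is non-empty, and that is constant 1 otherwise. -/
def DistanceRep (D : FunCode) (O : Set unitInterval) : Prop :=
  ∃ d : unitInterval → ℝ, Represents D d ∧ Continuous d ∧
    (Oᶜ.Nonempty → ∀ x, d x = Metric.infDist x Oᶜ) ∧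
    (O = Set.univ → ∀ x, d x = 1)

/-- `Δ` converts each representation (R.2) of an open set into a representation (R.3) of the same
set. -/
def IsDelta (Δ : FunCode → FunCode) : Prop :=
  ∀ (Y : FunCode) (O : Set unitInterval), IsOpen O → RadiusRep Y O → DistanceRep (Δ Y) O

/-- `M` is a Pincherle realiser: for `Y : [0, 1] → ℝ⁺`, the real `M(Y)` is positive and is a lower
bound of every `Z : [0, 1] → ℝ` that is locally bounded away from zero by `Y`. -/
def IsPincherleRealiser (M : FunCode → (ℕ → ℕ)) : Prop :=
  ∀ (Y : FunCode) (y : unitInterval → ℝ), Represents Y y → (∀ x, 0 < y x) →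
    0 < realOf (M Y) ∧
    ∀ Z : unitInterval → ℝ,
      (∀ x z : unitInterval, |(x : ℝ) - (z : ℝ)| < y x → y x < Z z) →
      ∀ z, realOf (M Y) ≤ Z z

/-! ### Objects of type `1 → 1` and `(1 → 1) → 1` as objects of pure type -/

/-- The sequence `n, f 0, f 1, …`. -/
def cons (n : ℕ) (f : ℕ → ℕ) : ℕ → ℕ
  | 0 => n
  | k + 1 => f k

/-- An object of type `1 → 1` as one of pure type 2: on the input `k, f 0, f 1, …` the value
is `Y f k`. This is a bijection. -/
def pure2 (Y : FunCode) (h : ℕ → ℕ) : ℕ := Y (fun i => h (i + 1)) (h 0)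

/-- An object of type `(1 → 1) → 1` as one of pure type 3: a type 2 object `H` codes the pair of
the number `H(0, 0, …)` and the type `1 → 1` object that `f ↦ H(1, f)` stands for, and every such
pair has a code. -/
def pure3 (M : FunCode → (ℕ → ℕ)) (H : (ℕ → ℕ) → ℕ) : ℕ :=
  M (fun f k => H (cons 1 (cons k f))) (H fun _ => 0)

/-- The value `Δ(Y)(f)(k)` is computed by the index `e`, with the parameters `L`. -/
def ComputesAt (e : ℕ) (L : List Arg) (Δ : FunCode → FunCode) (Y : FunCode) (f : ℕ → ℕ)
    (k : ℕ) : Prop :=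
  Kleene e (arg0 k :: arg1 f :: arg2 (pure2 Y) :: L) (Δ Y f k)

end KleeneHigher

namespace KleeneHigher

open Filter Topology

/-! ### Reordering and dropping arguments -/

/-- Adjacent blocks of arguments can be exchanged. -/
theorem exists_swap (n : ℕ) : ∀ c e : ℕ, ∃ e', ∀ (v u w : List Arg) (m : ℕ),
    v.length = c → u.length = n → Kleene e (u ++ v ++ w) m → Kleene e' (v ++ u ++ w) m := by
  induction n with
  | zero =>
    intro c e
    refine ⟨e, fun v u w m _ hu h => ?_⟩
    obtain rfl := List.length_eq_zero_iff.1 hu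
    simpa using h
  | succ n ih =>
    intro c e
    obtain ⟨g, hg⟩ := ih (c + 1) e
    refine ⟨idx 6 (c + n) g, fun v u w m hv hu h => ?_⟩
    obtain ⟨u', a, rfl⟩ : ∃ u' a, u = u' ++ [a] := by
      have hne : u ≠ [] := by rintro rfl; simp at hu
      exact ⟨u.dropLast, u.getLast hne, (List.dropLast_append_getLast hne).symm⟩
    have hu' : u'.length = n := by simpa using hu
    have h1 : Kleene g (a :: ((v ++ u') ++ w)) m := by
      simpa using hg (a :: v) u' w m (by simp [hv]) hu' (by simpa using h)
    have h2 := Kleene.s6 h1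
    simpa [hv, hu'] using h2

/-- A block of arguments can be ignored. -/
theorem exists_drop (c n r e : ℕ) : ∃ e', ∀ (v u w : List Arg) (m : ℕ),
    v.length = c → u.length = n → w.length = r → Kleene e (v ++ w) m →
      Kleene e' (v ++ u ++ w) m := by
  obtain ⟨e₁, h₁⟩ := exists_swap (c + r) n (idx 4 (idx 9 (c + r) 0) (idx 2 e 0))
  obtain ⟨e₂, h₂⟩ := exists_swap n c e₁
  refine ⟨e₂, fun v u w m hv hu hw h => h₂ v u w m hv hu ?_⟩
  have hl : (v ++ w).length = c + r := by simp [hv, hw]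
  have := h₁ u (v ++ w) [] m hu hl (by
    refine Kleene.s4 (Kleene.s2 e _) ?_
    have := Kleene.s9 (l₂ := u) h
    rw [hl] at this
    simpa using this)
  simpa using this

/-! ### Primitive recursive functions -/

/-- A list of number arguments. -/
def nums (v : List ℕ) : List Arg := v.map arg0

theorem exists_subst {n : ℕ} (gs : List (List.Vector ℕ n → ℕ))
    (hgs : ∀ g ∈ gs, ∃ e, ∀ v l, Kleene e (nums v.toList ++ l) (g v))
    (φ : List.Vector ℕ n → ℕ) (e : ℕ)
    (he : ∀ v l, Kleene e (nums (gs.map fun g => g v) ++ (nums v.toList ++ l)) (φ v)) :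
    ∃ e', ∀ v l, Kleene e' (nums v.toList ++ l) (φ v) := by
  induction gs generalizing e with
  | nil => exact ⟨e, by simpa [nums] using he⟩
  | cons g gs ih =>
    obtain ⟨a, ha⟩ := hgs g (by simp)
    obtain ⟨a', ha'⟩ := exists_swap n gs.length a
    refine ih (fun g' hg' => hgs g' (by simp [hg'])) (idx 4 e a') fun v l => ?_
    refine Kleene.s4 (n := g v) ?_ (by simpa [nums] using he v l)
    have := ha' (nums (gs.map fun g => g v)) (nums v.toList) l (g v) (by simp [nums])
      (by simp [nums]) (by simpa using ha v _)
    simpa using this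

theorem exists_primrec {n : ℕ} {φ : List.Vector ℕ n → ℕ} (h : Nat.Primrec' φ) :
    ∃ e, ∀ v l, Kleene e (nums v.toList ++ l) (φ v) := by
  induction h with
  | zero => exact ⟨idx 2 0 0, fun v l => Kleene.s2 0 _⟩
  | succ =>
    refine ⟨idx 1 0 0, fun v l => ?_⟩
    obtain ⟨x, w, rfl⟩ := v.exists_eq_cons
    exact Kleene.s1 x _
  | @get n i =>
    refine ⟨idx 6 i (idx 3 0 0), fun v l => ?_⟩
    have hi : (i : ℕ) < v.toList.length := by simp
    have h1 : v.toList = v.toList.take i ++ v.toList[(i : ℕ)] :: v.toList.drop (i + 1) := by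
      simp
    have h2 : v.toList[(i : ℕ)] = v.get i := by
      simp [List.Vector.get_eq_get_toList]
    have h3 := Kleene.s6 (l₁ := nums (v.toList.take i)) (l₂ := nums (v.toList.drop (i + 1)) ++ l)
      (Kleene.s3 (v.get i) _)
    have h4 : (nums (v.toList.take i)).length = i := by simp [nums]
    rw [h4] at h3
    rw [h1, h2]
    simpa [nums] using h3
  | @comp m n φ g _ _ ihf ihg =>
    obtain ⟨e, he⟩ := ihf
    refine exists_subst (List.ofFn g) ?_ _ e fun v l => ?_
    · intro g' hg'
      obtain ⟨i, rfl⟩ := List.mem_ofFn.1 hg'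
      exact ihg i
    · have := he (List.Vector.ofFn fun i => g i v) (nums v.toList ++ l)
      simpa [nums, List.map_ofFn, Function.comp_def] using this
  | @prec n φ ψ _ _ ihf ihg =>
    obtain ⟨a, ha⟩ := ihf
    obtain ⟨b, hb⟩ := ihg
    refine ⟨idx 5 a b, fun v l => ?_⟩
    obtain ⟨x, w, rfl⟩ := v.exists_eq_cons
    simp only [List.Vector.head_cons, List.Vector.tail_cons]
    induction x with
    | zero => exact Kleene.s5_zero (ha w l)
    | succ x ih =>
      refine Kleene.s5_succ (x := x) ih ?_
      have := hb (x ::ᵥ (Nat.rec (φ w) (fun y IH => ψ (y ::ᵥ IH ::ᵥ w)) x : ℕ) ::ᵥ w) l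
      exact this

/-! ### Functionals computable in `∃²` and the parameters -/

/-- An object of type `1 → 1` and one of type `(1 → 1) → 1`. -/
abbrev Param : Type := FunCode × (FunCode → (ℕ → ℕ))

/-- The arguments of type at least 1. -/
noncomputable def oracles (f : ℕ → ℕ) (p : Param) : List Arg :=
  [arg1 f, arg2 (pure2 p.1), arg2 existsTwo, arg3 (pure3 p.2)]

/-- The functional `φ` has an index. -/
def Comp (φ : ℕ → (ℕ → ℕ) → Param → ℕ) : Prop :=
  ∃ e, ∀ n f p, Kleene e (arg0 n :: oracles f p) (φ n f p)

/-- The functional `g` with values of type 1 has an index; the argument of its values and the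
number parameter are coded as one number. -/
def CompFun (g : ℕ → (ℕ → ℕ) → Param → ℕ → ℕ) : Prop :=
  Comp fun n f p => g n.unpair.2 f p n.unpair.1

theorem Comp.subst {ψ χ : ℕ → (ℕ → ℕ) → Param → ℕ} (hψ : Comp ψ) (hχ : Comp χ) :
    Comp fun n f p => ψ (χ n f p) f p := by
  obtain ⟨a, ha⟩ := hψ
  obtain ⟨b, hb⟩ := hχ
  obtain ⟨c, hc⟩ := exists_drop 1 1 4 a
  exact ⟨idx 4 c b, fun n f p => Kleene.s4 (hb n f p)
    (hc [arg0 _] [arg0 n] (oracles f p) _ rfl rfl rfl (ha _ f p))⟩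

theorem exists_primrec_two {φ : ℕ → ℕ → ℕ} (h : Primrec₂ φ) :
    ∃ e, ∀ x y l, Kleene e (arg0 x :: arg0 y :: l) (φ x y) := by
  obtain ⟨e, he⟩ := exists_primrec (n := 2) (φ := fun v => φ v.head v.tail.head)
    (Nat.Primrec'.of_prim (h.comp Primrec.vector_head
      (Primrec.vector_head.comp Primrec.vector_tail)))
  exact ⟨e, fun x y l => he (x ::ᵥ y ::ᵥ List.Vector.nil) l⟩

theorem exists_primrec_three {φ : ℕ → ℕ → ℕ → ℕ}
    (h : Primrec fun x : ℕ × ℕ × ℕ => φ x.1 x.2.1 x.2.2) :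
    ∃ e, ∀ x y z l, Kleene e (arg0 x :: arg0 y :: arg0 z :: l) (φ x y z) := by
  obtain ⟨e, he⟩ := exists_primrec (n := 3)
    (φ := fun v => φ v.head v.tail.head v.tail.tail.head)
    (Nat.Primrec'.of_prim (h.comp (Primrec.vector_head.pair ((Primrec.vector_head.comp
      Primrec.vector_tail).pair (Primrec.vector_head.comp (Primrec.vector_tail.comp
      Primrec.vector_tail))))))
  exact ⟨e, fun x y z l => he (x ::ᵥ y ::ᵥ z ::ᵥ List.Vector.nil) l⟩

theorem Comp.lift₂ {φ : ℕ → ℕ → ℕ} (h : Primrec₂ φ) {α β : ℕ → (ℕ → ℕ) → Param → ℕ}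
    (hα : Comp α) (hβ : Comp β) : Comp fun n f p => φ (α n f p) (β n f p) := by
  obtain ⟨e, he⟩ := exists_primrec_two h.swap
  obtain ⟨a, ha⟩ := hα
  obtain ⟨b, hb⟩ := hβ
  obtain ⟨b', hb'⟩ := exists_drop 0 1 5 b
  exact ⟨idx 4 (idx 4 e b') a, fun n f p => Kleene.s4 (ha n f p) (Kleene.s4
    (hb' [] [arg0 _] (arg0 n :: oracles f p) _ rfl rfl rfl (hb n f p)) (he _ _ _))⟩

theorem Comp.id : Comp fun n _ _ => n := ⟨idx 3 0 0, fun n _ _ => Kleene.s3 n _⟩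

theorem Comp.const (c : ℕ) : Comp fun _ _ _ => c := ⟨idx 2 c 0, fun _ _ _ => Kleene.s2 c _⟩

theorem Comp.lift {φ : ℕ → ℕ} (h : Primrec φ) {α : ℕ → (ℕ → ℕ) → Param → ℕ} (hα : Comp α) :
    Comp fun n f p => φ (α n f p) :=
  Comp.lift₂ (φ := fun x _ => φ x) (h.comp Primrec.fst) hα hα

theorem Comp.pair {α β : ℕ → (ℕ → ℕ) → Param → ℕ} (hα : Comp α) (hβ : Comp β) :
    Comp fun n f p => Nat.pair (α n f p) (β n f p) :=
  Comp.lift₂ Primrec₂.natPair hα hβ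

theorem Comp.fst {α : ℕ → (ℕ → ℕ) → Param → ℕ} (hα : Comp α) :
    Comp fun n f p => (α n f p).unpair.1 :=
  Comp.lift (Primrec.fst.comp Primrec.unpair) hα

theorem Comp.snd {α : ℕ → (ℕ → ℕ) → Param → ℕ} (hα : Comp α) :
    Comp fun n f p => (α n f p).unpair.2 :=
  Comp.lift (Primrec.snd.comp Primrec.unpair) hα

theorem CompFun.app {g : ℕ → (ℕ → ℕ) → Param → ℕ → ℕ} (hg : CompFun g)
    {α β : ℕ → (ℕ → ℕ) → Param → ℕ} (hα : Comp α) (hβ : Comp β) :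
    Comp fun n f p => g (α n f p) f p (β n f p) := by
  simpa using Comp.subst hg (hβ.pair hα)

theorem Comp.apply {α : ℕ → (ℕ → ℕ) → Param → ℕ} (hα : Comp α) :
    Comp fun n f p => f (α n f p) := by
  refine Comp.subst (ψ := fun n f _ => f n) ⟨idx 6 1 (idx 7 0 0), fun n f p => ?_⟩ hα
  exact Kleene.s6 (l₁ := [arg0 n]) (Kleene.s7 f n _)

/-- From an index for a function term to one that takes the bound variable as a separate
argument. -/
theorem CompFun.exists_bound {g : ℕ → (ℕ → ℕ) → Param → ℕ → ℕ} (hg : CompFun g) :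
    ∃ e, ∀ k n f p, Kleene e (arg0 k :: arg0 n :: oracles f p) (g n f p k) := by
  obtain ⟨a, ha⟩ := hg
  obtain ⟨b, hb⟩ := exists_primrec_two Primrec₂.natPair
  obtain ⟨c, hc⟩ := exists_drop 1 2 4 a
  refine ⟨idx 4 c b, fun k n f p => Kleene.s4 (hb k n _)
    (hc [arg0 _] [arg0 k, arg0 n] (oracles f p) _ rfl rfl rfl ?_)⟩
  simpa using ha (Nat.pair k n) f p

theorem CompFun.pure2 {g : ℕ → (ℕ → ℕ) → Param → ℕ → ℕ} (hg : CompFun g) :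
    Comp fun n f p => pure2 p.1 (g n f p) := by
  obtain ⟨a, ha⟩ := hg.exists_bound
  obtain ⟨b, hb⟩ := exists_swap 3 1 a
  refine ⟨idx 6 2 (idx 8 0 b), fun n f p => Kleene.s6 (l₁ := [arg0 n, arg1 f])
    (Kleene.s8 (j := 0) (KleeneHigher.pure2 p.1) fun k => ?_)⟩
  exact hb [arg2 _] [arg0 k, arg0 n, arg1 f] [arg2 existsTwo, arg3 (pure3 p.2)] _ rfl rfl
    (ha k n f p)

theorem CompFun.existsTwo {g : ℕ → (ℕ → ℕ) → Param → ℕ → ℕ} (hg : CompFun g) :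
    Comp fun n f p => existsTwo (g n f p) := by
  obtain ⟨a, ha⟩ := hg.exists_bound
  obtain ⟨b, hb⟩ := exists_swap 4 1 a
  refine ⟨idx 6 3 (idx 8 0 b), fun n f p => Kleene.s6 (l₁ := [arg0 n, arg1 f, arg2 _])
    (Kleene.s8 (j := 0) KleeneHigher.existsTwo fun k => ?_)⟩
  exact hb [arg2 _] [arg0 k, arg0 n, arg1 f, arg2 (KleeneHigher.pure2 p.1)] [arg3 (pure3 p.2)] _
    rfl rfl (ha k n f p)

theorem Comp.pure3 {ψ : ℕ → (ℕ → ℕ) → Param → ℕ} (hψ : Comp ψ) :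
    Comp fun n _ p => pure3 p.2 fun β => ψ n β p := by
  obtain ⟨a, ha⟩ := hψ
  obtain ⟨b, hb⟩ := exists_drop 2 1 3 a
  obtain ⟨c, hc⟩ := exists_swap 5 1 (idx 6 1 b)
  refine ⟨idx 6 4 (idx 8 1 c), fun n f p => Kleene.s6 (l₁ := [arg0 n, arg1 f, arg2 _, arg2 _])
    (Kleene.s8 (j := 1) (KleeneHigher.pure3 p.2) fun β => ?_)⟩
  refine hc [arg3 _] [arg1 β, arg0 n, arg1 f, arg2 (pure2 p.1), arg2 existsTwo] [] _ rfl rfl ?_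
  refine Kleene.s6 (l₁ := [arg1 β]) ?_
  exact hb [arg0 n, arg1 β] [arg1 f] [arg2 (pure2 p.1), arg2 existsTwo, arg3 _] _ rfl rfl rfl
    (ha n β p)

theorem CompFun.sum {g : ℕ → (ℕ → ℕ) → Param → ℕ → ℕ} (hg : CompFun g)
    {β : ℕ → (ℕ → ℕ) → Param → ℕ} (hβ : Comp β) :
    Comp fun n f p => ∑ i ∈ Finset.range (β n f p), g n f p i := by
  obtain ⟨a, ha⟩ := hg.exists_bound
  obtain ⟨b, hb⟩ := hβ
  obtain ⟨c, hc⟩ := exists_drop 1 1 5 a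
  obtain ⟨d, hd⟩ := exists_primrec_three (φ := fun x _ z => x + z)
    (Primrec.nat_add.comp Primrec.fst (Primrec.snd.comp Primrec.snd))
  refine ⟨idx 4 (idx 5 (idx 2 0 0) (idx 4 d c)) b, fun n f p => Kleene.s4 (hb n f p) ?_⟩
  beta_reduce
  generalize β n f p = x
  induction x with
  | zero => exact Kleene.s5_zero (Kleene.s2 0 _)
  | succ x ih =>
    refine Kleene.s5_succ ih (Kleene.s4 (n := g n f p x) ?_ ?_)
    · exact hc [arg0 x] [arg0 _] (arg0 n :: oracles f p) _ rfl rfl rfl (ha x n f p)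
    · rw [Finset.sum_range_succ, add_comm]
      exact hd _ _ _ _

/-! ### Decidable predicates -/

open Classical in
/-- The predicate `P` has a characteristic functional with an index; the value 0 stands for truth,
as it does for `∃²`. -/
def Dec (P : ℕ → (ℕ → ℕ) → Param → Prop) : Prop :=
  Comp fun n f p => if P n f p then 0 else 1

theorem Dec.congr {P Q : ℕ → (ℕ → ℕ) → Param → Prop} (hP : Dec P)
    (h : ∀ n f p, P n f p ↔ Q n f p) : Dec Q := by
  have : P = Q := by
    funext n f p
    exact propext (h n f p)
  exact this ▸ hP

theorem Dec.subst {P : ℕ → (ℕ → ℕ) → Param → Prop} (hP : Dec P)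
    {χ : ℕ → (ℕ → ℕ) → Param → ℕ} (hχ : Comp χ) : Dec fun n f p => P (χ n f p) f p :=
  Comp.subst hP hχ

theorem Dec.lt {α β : ℕ → (ℕ → ℕ) → Param → ℕ} (hα : Comp α) (hβ : Comp β) :
    Dec fun n f p => α n f p < β n f p := by
  have h : Primrec₂ fun a b : ℕ => if a < b then 0 else 1 :=
    Primrec.ite Primrec.nat_lt (Primrec.const 0) (Primrec.const 1)
  unfold Dec
  convert Comp.lift₂ h hα hβ

theorem Dec.not {P : ℕ → (ℕ → ℕ) → Param → Prop} (hP : Dec P) : Dec fun n f p => ¬ P n f p := by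
  have := Comp.lift₂ Primrec.nat_sub (Comp.const 1) hP
  unfold Dec
  convert this using 5 with n f p
  by_cases h : P n f p <;> simp [h]

theorem Dec.or {P Q : ℕ → (ℕ → ℕ) → Param → Prop} (hP : Dec P) (hQ : Dec Q) :
    Dec fun n f p => P n f p ∨ Q n f p := by
  have := Comp.lift₂ Primrec.nat_mul hP hQ
  unfold Dec
  convert this using 5 with n f p
  by_cases h : P n f p <;> by_cases h' : Q n f p <;> simp [h, h']

theorem Dec.and {P Q : ℕ → (ℕ → ℕ) → Param → Prop} (hP : Dec P) (hQ : Dec Q) :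
    Dec fun n f p => P n f p ∧ Q n f p :=
  (hP.not.or hQ.not).not.congr fun _ _ _ => by tauto

theorem Dec.imp {P Q : ℕ → (ℕ → ℕ) → Param → Prop} (hP : Dec P) (hQ : Dec Q) :
    Dec fun n f p => P n f p → Q n f p :=
  (hP.not.or hQ).congr fun _ _ _ => by tauto

theorem Dec.le {α β : ℕ → (ℕ → ℕ) → Param → ℕ} (hα : Comp α) (hβ : Comp β) :
    Dec fun n f p => α n f p ≤ β n f p :=
  (Dec.lt hβ hα).not.congr fun _ _ _ => not_lt

theorem Dec.eq {α β : ℕ → (ℕ → ℕ) → Param → ℕ} (hα : Comp α) (hβ : Comp β) :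
    Dec fun n f p => α n f p = β n f p :=
  ((Dec.le hα hβ).and (Dec.le hβ hα)).congr fun _ _ _ => le_antisymm_iff.symm

theorem Dec.exists {Q : ℕ → (ℕ → ℕ) → Param → ℕ → Prop}
    (hQ : Dec fun n f p => Q n.unpair.2 f p n.unpair.1) : Dec fun n f p => ∃ i, Q n f p i := by
  classical
  have := CompFun.existsTwo (g := fun n f p i => if Q n f p i then 0 else 1) hQ
  unfold Dec
  convert this using 5 with n f p
  simp [KleeneHigher.existsTwo]

theorem Dec.forall {Q : ℕ → (ℕ → ℕ) → Param → ℕ → Prop}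
    (hQ : Dec fun n f p => Q n.unpair.2 f p n.unpair.1) : Dec fun n f p => ∀ i, Q n f p i :=
  (Dec.exists (Q := fun n f p i => ¬ Q n f p i) hQ.not).not.congr fun _ _ _ => by simp

theorem Comp.ite {P : ℕ → (ℕ → ℕ) → Param → Prop} {α β : ℕ → (ℕ → ℕ) → Param → ℕ}
    [∀ n f p, Decidable (P n f p)] (hP : Dec P) (hα : Comp α) (hβ : Comp β) :
    Comp fun n f p => if P n f p then α n f p else β n f p := by
  have := Comp.lift₂ Primrec.nat_add
    (Comp.lift₂ Primrec.nat_mul (Comp.lift₂ Primrec.nat_sub (Comp.const 1) hP) hα)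
    (Comp.lift₂ Primrec.nat_mul hP hβ)
  convert this using 4 with n f p
  by_cases h : P n f p <;> simp [h]

open Classical in
/-- The number of `i < k` with property `Q`. -/
noncomputable def count (Q : ℕ → Prop) (k : ℕ) : ℕ :=
  ∑ i ∈ Finset.range k, if Q i then 1 else 0

theorem Dec.count {Q : ℕ → (ℕ → ℕ) → Param → ℕ → Prop}
    (hQ : Dec fun n f p => Q n.unpair.2 f p n.unpair.1) {α : ℕ → (ℕ → ℕ) → Param → ℕ}
    (hα : Comp α) : Comp fun n f p => count (Q n f p) (α n f p) := by
  classical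
  exact CompFun.sum (g := fun n f p i => if Q n f p i then 1 else 0)
    (Comp.ite hQ (Comp.const 1) (Comp.const 0)) hα

/-! ### Rational numbers and the hat of a sequence -/

/-- The numerator of the distance of two rationals, given by codes. -/
def distNum (x y : ℕ) : ℕ :=
  let a := x.unpair.1 * (y.unpair.2.unpair.2 + 1) + y.unpair.2.unpair.1 * (x.unpair.2.unpair.2 + 1)
  let b := x.unpair.2.unpair.1 * (y.unpair.2.unpair.2 + 1) + y.unpair.1 * (x.unpair.2.unpair.2 + 1)
  (a - b) + (b - a)

/-- The denominator of the distance of two rationals, given by codes. -/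
def distDen (x y : ℕ) : ℕ := (x.unpair.2.unpair.2 + 1) * (y.unpair.2.unpair.2 + 1)

theorem distDen_pos (x y : ℕ) : 0 < distDen x y := by unfold distDen; positivity

theorem abs_ratOf_sub (x y : ℕ) : |ratOf x - ratOf y| = (distNum x y : ℚ) / distDen x y := by
  have key : ∀ a b : ℕ, (((a - b) + (b - a) : ℕ) : ℚ) = |(a : ℚ) - b| := by
    intro a b
    rcases le_total a b with h | h
    · rw [abs_of_nonpos (by simpa using h), Nat.sub_eq_zero_of_le h]
      push_cast [Nat.cast_sub h]
      ring
    · rw [abs_of_nonneg (by simpa using h), Nat.sub_eq_zero_of_le h]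
      push_cast [Nat.cast_sub h]
      ring
  have hd : (0 : ℚ) < distDen x y := by exact_mod_cast distDen_pos x y
  rw [distNum, key]
  rw [eq_div_iff hd.ne', ← abs_of_pos hd, ← abs_mul]
  congr 1
  unfold ratOf distDen
  push_cast
  field_simp
  ring

theorem Comp.add {α β : ℕ → (ℕ → ℕ) → Param → ℕ} (hα : Comp α) (hβ : Comp β) :
    Comp fun n f p => α n f p + β n f p := Comp.lift₂ Primrec.nat_add hα hβ

theorem Comp.mul {α β : ℕ → (ℕ → ℕ) → Param → ℕ} (hα : Comp α) (hβ : Comp β) :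
    Comp fun n f p => α n f p * β n f p := Comp.lift₂ Primrec.nat_mul hα hβ

theorem Comp.sub {α β : ℕ → (ℕ → ℕ) → Param → ℕ} (hα : Comp α) (hβ : Comp β) :
    Comp fun n f p => α n f p - β n f p := Comp.lift₂ Primrec.nat_sub hα hβ

theorem Comp.twoPow {α : ℕ → (ℕ → ℕ) → Param → ℕ} (hα : Comp α) :
    Comp fun n f p => 2 ^ α n f p := by
  refine Comp.lift (φ := fun n => 2 ^ n) ?_ hα
  exact (Primrec.nat_rec₁ 1 (Primrec.nat_mul.comp Primrec.snd (Primrec.const 2)).to₂).of_eq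
    fun n => by induction n with
      | zero => rfl
      | succ n ih => rw [pow_succ, ← ih]

theorem Comp.distNum {α β : ℕ → (ℕ → ℕ) → Param → ℕ} (hα : Comp α) (hβ : Comp β) :
    Comp fun n f p => distNum (α n f p) (β n f p) := by
  have ha := (hα.fst.mul (hβ.snd.snd.add (Comp.const 1))).add
    (hβ.snd.fst.mul (hα.snd.snd.add (Comp.const 1)))
  have hb := (hα.snd.fst.mul (hβ.snd.snd.add (Comp.const 1))).add
    (hβ.fst.mul (hα.snd.snd.add (Comp.const 1)))
  exact (ha.sub hb).add (hb.sub ha)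

theorem Comp.distDen {α β : ℕ → (ℕ → ℕ) → Param → ℕ} (hα : Comp α) (hβ : Comp β) :
    Comp fun n f p => distDen (α n f p) (β n f p) :=
  (hα.snd.snd.add (Comp.const 1)).mul (hβ.snd.snd.add (Comp.const 1))

theorem fastUpTo_iff (g : ℕ → ℕ) (m : ℕ) : FastUpTo (fun k => ratOf (g k)) m ↔
    ∀ t : ℕ, t.unpair.2 ≤ m → t.unpair.1 ≤ t.unpair.2 →
      2 ^ t.unpair.1 * distNum (g t.unpair.1) (g t.unpair.2)
        < distDen (g t.unpair.1) (g t.unpair.2) := by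
  have key : ∀ i j : ℕ, |ratOf (g i) - ratOf (g j)| < (1 / 2) ^ i ↔
      2 ^ i * distNum (g i) (g j) < distDen (g i) (g j) := by
    intro i j
    have hd : (0 : ℚ) < distDen (g i) (g j) := by exact_mod_cast distDen_pos _ _
    rw [abs_ratOf_sub, div_lt_iff₀ hd, div_pow, one_pow, one_div, inv_mul_eq_div,
      lt_div_iff₀ (by positivity), mul_comm]
    exact_mod_cast Iff.rfl
  constructor
  · exact fun h t h1 h2 => (key _ _).1 (h _ h1 _ h2)
  · intro h j hj i hi
    have := h (Nat.pair i j)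
    simp only [Nat.unpair_pair] at this
    exact (key _ _).2 (this hj hi)

/-- The code of the rational number `hat q m`, where `q` is the sequence coded by `g`. -/
def hatCode (g : ℕ → ℕ) (m : ℕ) : ℕ := g (Nat.findGreatest (FastUpTo fun k => ratOf (g k)) m)

theorem findGreatest_eq_count {P : ℕ → Prop} [DecidablePred P]
    (hP : ∀ a b, a ≤ b → P b → P a) (m : ℕ) :
    Nat.findGreatest P m = count (fun i => P (i + 1)) m := by
  induction m with
  | zero => simp [count]
  | succ m ih =>
    rw [count, Finset.sum_range_succ, ← count, ← ih, Nat.findGreatest_succ]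
    by_cases h : P (m + 1)
    · have : Nat.findGreatest P m = m := by
        rcases Nat.eq_zero_or_pos m with rfl | hm
        · simp
        · exact le_antisymm (Nat.findGreatest_le m)
            (Nat.le_findGreatest le_rfl (hP _ _ (Nat.le_succ m) h))
      simp [h, this]
    · simp [h]

theorem CompFun.hatCode {g : ℕ → (ℕ → ℕ) → Param → ℕ → ℕ} (hg : CompFun g) :
    CompFun fun n f p => hatCode (g n f p) := by
  have h1 : CompFun fun n f p m =>
      count (fun i => FastUpTo (fun k => ratOf (g n f p k)) (i + 1)) m := by
    refine Dec.count (Q := fun n f p i =>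
      FastUpTo (fun k => ratOf (g n.unpair.2 f p k)) (i + 1)) ?_ Comp.id.fst
    simp only [fastUpTo_iff]
    refine Dec.forall (Q := fun n f p t => t.unpair.2 ≤ n.unpair.1 + 1 →
      t.unpair.1 ≤ t.unpair.2 →
      2 ^ t.unpair.1 * KleeneHigher.distNum (g n.unpair.2.unpair.2 f p t.unpair.1)
        (g n.unpair.2.unpair.2 f p t.unpair.2)
        < KleeneHigher.distDen (g n.unpair.2.unpair.2 f p t.unpair.1)
          (g n.unpair.2.unpair.2 f p t.unpair.2)) ?_
    have ht : Comp fun n _ _ => n.unpair.1 := Comp.id.fst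
    have hn : Comp fun n _ _ => n.unpair.2 := Comp.id.snd
    have g1 := CompFun.app hg hn.snd.snd ht.fst
    have g2 := CompFun.app hg hn.snd.snd ht.snd
    exact (Dec.le ht.snd (hn.fst.add (Comp.const 1))).imp ((Dec.le ht.fst ht.snd).imp
      (Dec.lt (ht.fst.twoPow.mul (g1.distNum g2)) (g1.distDen g2)))
  refine Comp.subst (ψ := fun n f p => g n.unpair.2 f p n.unpair.1) hg
    (Comp.pair h1 Comp.id.snd) |> fun h => ?_
  simp only [Nat.unpair_pair] at h
  unfold CompFun
  convert h using 4 with n f p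
  beta_reduce
  unfold KleeneHigher.hatCode
  rw [findGreatest_eq_count]
  intro a b hab hb j hj
  exact hb j (hj.trans hab)

theorem abs_hat_sub_realOf_le (g : ℕ → ℕ) (i : ℕ) :
    |(ratOf (hatCode g i) : ℝ) - realOf g| ≤ (1 / 2) ^ i := by
  have h := (tendsto_realOf g).const_sub ((ratOf (hatCode g i) : ℚ) : ℝ) |>.abs
  refine le_of_tendsto h (eventually_atTop.2 ⟨i, fun j hj => ?_⟩)
  have := (Rat.cast_le (K := ℝ)).2 (hat_fast (fun k => ratOf (g k)) hj).le
  push_cast at this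
  exact this

/-- A sequence that converges fast enough to `x` represents `x`. -/
theorem realOf_eq {g : ℕ → ℕ} {x : ℝ}
    (h : ∀ k, |(ratOf (g k) : ℝ) - x| ≤ (1 / 2) ^ (k + 2)) : realOf g = x := by
  have hfast : ∀ m, FastUpTo (fun k => ratOf (g k)) m := by
    intro m j _ i hi
    have h1 : |(ratOf (g i) : ℝ) - ratOf (g j)| < (1 / 2) ^ i := by
      have hi' := h i
      have hj' := h j
      have hm : (1 / 2 : ℝ) ^ (j + 2) ≤ (1 / 2) ^ (i + 2) :=
        pow_le_pow_of_le_one (by norm_num) (by norm_num) (by omega)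
      have hp : (1 / 2 : ℝ) ^ (i + 2) = (1 / 2) ^ i / 4 := by ring
      have hpos : (0 : ℝ) < (1 / 2) ^ i := by positivity
      rw [abs_le] at hi' hj'
      rw [abs_lt]
      constructor <;> linarith
    refine (Rat.cast_lt (K := ℝ)).1 ?_
    push_cast
    exact h1
  have hhat : ∀ n, hat (fun k => ratOf (g k)) n = ratOf (g n) := fun n => by
    unfold hat
    rw [le_antisymm (Nat.findGreatest_le n) (Nat.le_findGreatest le_rfl (hfast n))]
  have h1 := tendsto_realOf g
  simp only [hhat] at h1
  refine tendsto_nhds_unique h1 ?_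
  rw [tendsto_iff_dist_tendsto_zero]
  refine squeeze_zero (fun _ => dist_nonneg) (fun n => h n) ?_
  exact (tendsto_pow_atTop_nhds_zero_of_lt_one (r := (1 / 2 : ℝ)) (by norm_num)
    (by norm_num)).comp (tendsto_add_atTop_nat 2)

/-- The distance of the real coded by `g` to the rational coded by `c` is greater than
`2⁻ᵐ + j / 2ᴷ`. -/
def Far (c K j m : ℕ) (g : ℕ → ℕ) : Prop :=
  (1 / 2 : ℝ) ^ m + j / 2 ^ K < |realOf g - ratOf c|

theorem far_iff (c K j m : ℕ) (g : ℕ → ℕ) : Far c K j m g ↔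
    ∃ i, (2 ^ (i + K) + 2 ^ (m + K) + j * 2 ^ (m + i)) * distDen (hatCode g i) c
      < distNum (hatCode g i) c * 2 ^ (m + i + K) := by
  have key : ∀ i, (2 ^ (i + K) + 2 ^ (m + K) + j * 2 ^ (m + i)) * distDen (hatCode g i) c
      < distNum (hatCode g i) c * 2 ^ (m + i + K) ↔
      (1 / 2 : ℝ) ^ m + j / 2 ^ K + (1 / 2) ^ i < |(ratOf (hatCode g i) : ℝ) - ratOf c| := by
    intro i
    have h1 : |(ratOf (hatCode g i) : ℝ) - ratOf c|
        = (distNum (hatCode g i) c : ℝ) / distDen (hatCode g i) c := by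
      have := congrArg (Rat.cast (K := ℝ)) (abs_ratOf_sub (hatCode g i) c)
      push_cast at this
      exact this
    have hd : (0 : ℝ) < distDen (hatCode g i) c := by exact_mod_cast distDen_pos _ _
    have h2 : (1 / 2 : ℝ) ^ m + j / 2 ^ K + (1 / 2) ^ i
        = (2 ^ (i + K) + 2 ^ (m + K) + j * 2 ^ (m + i)) / 2 ^ (m + i + K) := by
      rw [div_pow, div_pow, one_pow, one_pow, pow_add, pow_add, pow_add, pow_add]
      field_simp
      ring
    rw [h1, h2, div_lt_div_iff₀ (by positivity) hd, ← Nat.cast_lt (α := ℝ)]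
    push_cast
    exact Iff.rfl
  simp only [key]
  unfold Far
  constructor
  · intro h
    obtain ⟨i, hi⟩ := exists_pow_lt_of_lt_one (half_pos (sub_pos.2 h))
      (by norm_num : (1 / 2 : ℝ) < 1)
    refine ⟨i, ?_⟩
    have h1 := abs_hat_sub_realOf_le g i
    have h2 := abs_sub_le (realOf g) (ratOf (hatCode g i) : ℝ) (ratOf c)
    rw [abs_sub_comm (realOf g) (ratOf (hatCode g i) : ℝ)] at h2
    linarith
  · rintro ⟨i, hi⟩
    have h1 := abs_hat_sub_realOf_le g i
    have h2 := abs_sub_le (ratOf (hatCode g i) : ℝ) (realOf g) (ratOf c)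
    linarith

theorem CompFun.far {g : ℕ → (ℕ → ℕ) → Param → ℕ → ℕ} (hg : CompFun g)
    {c K j m : ℕ → (ℕ → ℕ) → Param → ℕ} (hc : Comp c) (hK : Comp K) (hj : Comp j) (hm : Comp m) :
    Dec fun n f p => Far (c n f p) (K n f p) (j n f p) (m n f p) (g n f p) := by
  simp only [far_iff]
  refine Dec.exists (Q := fun n f p i =>
    (2 ^ (i + K n f p) + 2 ^ (m n f p + K n f p) + j n f p * 2 ^ (m n f p + i))
      * KleeneHigher.distDen (KleeneHigher.hatCode (g n f p) i) (c n f p)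
      < KleeneHigher.distNum (KleeneHigher.hatCode (g n f p) i) (c n f p)
        * 2 ^ (m n f p + i + K n f p)) ?_
  have hi : Comp fun n _ _ => n.unpair.1 := Comp.id.fst
  have hn : Comp fun n _ _ => n.unpair.2 := Comp.id.snd
  have hh := CompFun.app hg.hatCode hn hi
  have hc' := Comp.subst hc hn
  have hK' := Comp.subst hK hn
  have hj' := Comp.subst hj hn
  have hm' := Comp.subst hm hn
  exact Dec.lt (Comp.mul (((hi.add hK').twoPow.add (hm'.add hK').twoPow).add
    (hj'.mul (hm'.add hi).twoPow)) (hh.distDen hc'))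
    ((hh.distNum hc').mul ((hm'.add hi).add hK').twoPow)

/-! ### The auxiliary radius function and the test for closed intervals -/

/-- The code of `t / 2ˢ`. -/
def fracCode (t s : ℕ) : ℕ := Nat.pair t (Nat.pair 0 (2 ^ s - 1))

theorem ratOf_fracCode (t s : ℕ) : ratOf (fracCode t s) = t / 2 ^ s := by
  unfold ratOf fracCode
  simp [Nat.cast_sub Nat.one_le_two_pow]

/-- The ball of radius `2⁻ᵐ` around the real coded by `β` avoids the part of the interval with
centre `c` and radius `j / 2ᴷ` outside `O`, for one of the obvious reasons. -/
def Escapes (Y : FunCode) (c K j : ℕ) (β : ℕ → ℕ) (m : ℕ) : Prop :=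
  Far 0 0 0 m (Y β) ∨ Far c K j m β ∨ Far (fracCode 1 1) 1 1 m β

/-- The condition on the exponent of the auxiliary radius. -/
def Stops (Y : FunCode) (c K j n : ℕ) (β : ℕ → ℕ) (m : ℕ) : Prop :=
  Escapes Y c K j β m ∨ n ≤ m ∧ ∀ m', ¬ Escapes Y c K j β m'

/-- The auxiliary radius function: the radius is `2⁻ᵐ` for the least `m` with
`Stops Y c K j n β m`. -/
noncomputable def radius (Y : FunCode) (c K j n : ℕ) : FunCode := fun β k =>
  fracCode 1 (count (fun m => ¬ Stops Y c K j n β m) (k + 2))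

/-- The interval with centre `c` and radius `j / 2ᴷ` is a subset of `O`, as tested by a
Pincherle realiser. -/
def Inside (p : Param) (c K j : ℕ) : Prop :=
  ∀ n k, p.2 (radius p.1 c K j n) k = p.2 (radius p.1 c K j 0) k

/-- The `Δ`-functional. -/
noncomputable def deltaOf (p : Param) (f : ℕ → ℕ) (k : ℕ) : ℕ :=
  fracCode (count (fun j => Inside p (hatCode f (k + 3)) (k + 3) (j + 1)) (2 ^ (k + 3))) (k + 3)

theorem Comp.fracCode {α β : ℕ → (ℕ → ℕ) → Param → ℕ} (hα : Comp α) (hβ : Comp β) :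
    Comp fun n f p => fracCode (α n f p) (β n f p) :=
  hα.pair ((Comp.const 0).pair (hβ.twoPow.sub (Comp.const 1)))

theorem CompFun.comp {g : ℕ → (ℕ → ℕ) → Param → ℕ → ℕ} (hg : CompFun g)
    {α : ℕ → (ℕ → ℕ) → Param → ℕ} (hα : Comp α) : CompFun fun n f p => g (α n f p) f p :=
  CompFun.app hg (Comp.subst hα Comp.id.snd) Comp.id.fst

theorem Dec.escapes {β : ℕ → (ℕ → ℕ) → Param → ℕ → ℕ} (hβ : CompFun β)
    (hY : CompFun fun n f p => p.1 (β n f p))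
    {c K j m : ℕ → (ℕ → ℕ) → Param → ℕ} (hc : Comp c) (hK : Comp K) (hj : Comp j) (hm : Comp m) :
    Dec fun n f p => Escapes p.1 (c n f p) (K n f p) (j n f p) (β n f p) (m n f p) :=
  (hY.far (Comp.const 0) (Comp.const 0) (Comp.const 0) hm).or ((hβ.far hc hK hj hm).or
    (hβ.far (Comp.const _) (Comp.const 1) (Comp.const 1) hm))

theorem Comp.radius {β : ℕ → (ℕ → ℕ) → Param → ℕ → ℕ} (hβ : CompFun β)
    (hY : CompFun fun n f p => p.1 (β n f p)) {c K j a k : ℕ → (ℕ → ℕ) → Param → ℕ}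
    (hc : Comp c) (hK : Comp K) (hj : Comp j) (ha : Comp a) (hk : Comp k) :
    Comp fun n f p =>
      radius p.1 (c n f p) (K n f p) (j n f p) (a n f p) (β n f p) (k n f p) := by
  refine Comp.fracCode (Comp.const 1) (Dec.count (Q := fun n f p m =>
    ¬ Stops p.1 (c n f p) (K n f p) (j n f p) (a n f p) (β n f p) m) (Dec.not ?_) (hk.add (Comp.const 2)))
  have hm : Comp fun n _ _ => n.unpair.1 := Comp.id.fst
  have hn : Comp fun n _ _ => n.unpair.2 := Comp.id.snd
  refine (Dec.escapes (hβ.comp hn) (hY.comp hn) (hc.subst hn) (hK.subst hn) (hj.subst hn) hm).or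
    ((Dec.le (ha.subst hn) hm).and ?_)
  refine Dec.forall (Q := fun n f p m => ¬ Escapes p.1 (c n.unpair.2 f p) (K n.unpair.2 f p)
    (j n.unpair.2 f p) (β n.unpair.2 f p) m) ?_
  exact (Dec.escapes (hβ.comp hn.snd) (hY.comp hn.snd) (hc.subst hn.snd) (hK.subst hn.snd)
    (hj.subst hn.snd) hm).not

theorem comp_pincherle {c K j a k : ℕ → ℕ} (hc : Comp fun n _ _ => c n)
    (hK : Comp fun n _ _ => K n) (hj : Comp fun n _ _ => j n) (ha : Comp fun n _ _ => a n)
    (hk : Comp fun n _ _ => k n) :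
    Comp fun n _ p => p.2 (radius p.1 (c n) (K n) (j n) (a n)) (k n) := by
  have hβ : CompFun fun _ f _ i => f (i + 2) := (Comp.id.fst.add (Comp.const 2)).apply
  have hY : CompFun fun _ f p => p.1 fun i => f (i + 2) := by
    have h : CompFun fun n f _ => cons n.unpair.1 fun i => f (i + 2) := by
      have := Comp.ite (Dec.eq Comp.id.fst (Comp.const 0)) Comp.id.snd.fst
        (Comp.id.fst.add (Comp.const 1)).apply
      unfold CompFun
      convert this using 4 with n f p
      rcases n.unpair.1 with _ | i <;> rfl
    have := h.pure2
    simp only [pure2, cons] at this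
    exact this
  have h := Comp.pure3 (Comp.ite (Dec.eq (Comp.apply (Comp.const 0)) (Comp.const 0)) hk
    (Comp.radius hβ hY hc hK hj ha (Comp.apply (Comp.const 1))))
  simpa [pure3, cons] using h

theorem Dec.inside {c K j : ℕ → (ℕ → ℕ) → Param → ℕ}
    (hc : Comp c) (hK : Comp K) (hj : Comp j) :
    Dec fun n f p => Inside p (c n f p) (K n f p) (j n f p) := by
  have h : Dec fun n _ p => Inside p n.unpair.1 n.unpair.2.unpair.1 n.unpair.2.unpair.2 := by
    refine Dec.forall (Q := fun n _ p a =>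
      ∀ k, p.2 (radius p.1 n.unpair.1 n.unpair.2.unpair.1 n.unpair.2.unpair.2 a) k =
        p.2 (radius p.1 n.unpair.1 n.unpair.2.unpair.1 n.unpair.2.unpair.2 0) k) ?_
    refine Dec.forall (Q := fun n _ p k =>
      p.2 (radius p.1 n.unpair.2.unpair.1 n.unpair.2.unpair.2.unpair.1
        n.unpair.2.unpair.2.unpair.2 n.unpair.1) k =
        p.2 (radius p.1 n.unpair.2.unpair.1 n.unpair.2.unpair.2.unpair.1
          n.unpair.2.unpair.2.unpair.2 0) k) ?_
    have hs : Comp fun n _ _ => n.unpair.2.unpair.2 := Comp.id.snd.snd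
    exact Dec.eq (comp_pincherle hs.fst hs.snd.fst hs.snd.snd Comp.id.snd.fst Comp.id.fst)
      (comp_pincherle hs.fst hs.snd.fst hs.snd.snd (Comp.const 0) Comp.id.fst)
  exact (h.subst (hc.pair (hK.pair hj))).congr fun n f p => by simp only [Nat.unpair_pair]

theorem comp_deltaOf : Comp fun n f p => deltaOf p f n := by
  have hf : CompFun fun _ f _ => f := Comp.id.fst.apply
  have hk : Comp fun n _ _ => n.unpair.2 + 3 := Comp.id.snd.add (Comp.const 3)
  refine Comp.fracCode (Dec.count (Q := fun n f p j =>
    Inside p (hatCode f (n + 3)) (n + 3) (j + 1)) (Dec.inside ?_ hk ?_) ?_) ?_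
  · exact CompFun.app hf.hatCode Comp.id hk
  · exact Comp.id.fst.add (Comp.const 1)
  · exact (Comp.id.add (Comp.const 3)).twoPow
  · exact Comp.id.add (Comp.const 3)

theorem le_count {Q : ℕ → Prop} {a k : ℕ} (hak : a ≤ k) (h : ∀ i < a, Q i) : a ≤ count Q k := by
  classical
  have h1 : Finset.range a ⊆ (Finset.range k).filter Q := fun i hi => by
    have := Finset.mem_range.1 hi
    exact Finset.mem_filter.2 ⟨Finset.mem_range.2 (by omega), h i this⟩
  simpa [count] using Finset.card_le_card h1

theorem count_le {Q : ℕ → Prop} {a : ℕ} (k : ℕ) (h : ∀ i, a ≤ i → ¬ Q i) : count Q k ≤ a := by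
  classical
  have h1 : (Finset.range k).filter Q ⊆ Finset.range a := fun i hi => by
    by_contra hia
    exact h i (by simpa using hia) (Finset.mem_filter.1 hi).2
  simpa [count] using Finset.card_le_card h1

theorem count_le_self (Q : ℕ → Prop) (k : ℕ) : count Q k ≤ k := by
  classical
  simpa [count] using Finset.card_filter_le (Finset.range k) Q

theorem Far.mono {c K j m m' : ℕ} {g : ℕ → ℕ} (h : Far c K j m g) (hm : m ≤ m') :
    Far c K j m' g := by
  unfold Far at *
  have : (1 / 2 : ℝ) ^ m' ≤ (1 / 2) ^ m :=
    pow_le_pow_of_le_one (by norm_num) (by norm_num) hm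
  linarith

theorem Escapes.mono {Y : FunCode} {c K j m m' : ℕ} {β : ℕ → ℕ} (h : Escapes Y c K j β m)
    (hm : m ≤ m') : Escapes Y c K j β m' :=
  h.imp (·.mono hm) (Or.imp (·.mono hm) (·.mono hm))

theorem Stops.mono {Y : FunCode} {c K j n m m' : ℕ} {β : ℕ → ℕ} (h : Stops Y c K j n β m)
    (hm : m ≤ m') : Stops Y c K j n β m' :=
  h.imp (·.mono hm) (fun h => ⟨h.1.trans hm, h.2⟩)

theorem exists_stops (Y : FunCode) (c K j n : ℕ) (β : ℕ → ℕ) : ∃ m, Stops Y c K j n β m := by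
  by_cases h : ∃ m, Escapes Y c K j β m
  · exact h.imp fun m hm => Or.inl hm
  · exact ⟨n, Or.inr ⟨le_rfl, not_exists.1 h⟩⟩

theorem realOf_radius (Y : FunCode) (c K j n : ℕ) (β : ℕ → ℕ) :
    realOf (radius Y c K j n β) = (1 / 2) ^ sInf {m | Stops Y c K j n β m} := by
  set a := sInf {m | Stops Y c K j n β m} with ha
  have hmem : Stops Y c K j n β a := Nat.sInf_mem (exists_stops Y c K j n β)
  refine realOf_eq fun k => ?_
  have hcount : count (fun m => ¬ Stops Y c K j n β m) (k + 2) = min a (k + 2) := by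
    refine le_antisymm (le_min ?_ (count_le_self _ _)) ?_
    · exact count_le _ fun i hi h => h (hmem.mono hi)
    · exact le_count (min_le_right _ _) fun i hi =>
        Nat.notMem_of_lt_sInf (lt_of_lt_of_le hi (min_le_left _ _))
  rw [radius, ratOf_fracCode, hcount]
  push_cast
  rw [← one_div_pow]
  rcases le_total a (k + 2) with h | h
  · rw [min_eq_left h, sub_self, abs_zero]
    positivity
  · have h1 : (1 / 2 : ℝ) ^ a ≤ (1 / 2) ^ (k + 2) :=
      pow_le_pow_of_le_one (by norm_num) (by norm_num) h
    have h2 : (0 : ℝ) < (1 / 2) ^ a := by positivity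
    rw [min_eq_right h, abs_of_nonneg (by linarith)]
    linarith

theorem exists_far {c K j : ℕ} {g : ℕ → ℕ} (h : (j : ℝ) / 2 ^ K < |realOf g - ratOf c|) :
    ∃ m, Far c K j m g := by
  obtain ⟨m, hm⟩ := exists_pow_lt_of_lt_one (sub_pos.2 h) (by norm_num : (1 / 2 : ℝ) < 1)
  exact ⟨m, by unfold Far; linarith⟩

theorem exists_represents_radius {Y : FunCode} {y : unitInterval → ℝ} (hY : Represents Y y)
    (c K j n : ℕ) : ∃ d : unitInterval → ℝ, Represents (radius Y c K j n) d ∧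
      (∀ x, 0 < d x) ∧ (∀ x, d x ≤ 1) ∧ ∀ x, d x ≤ (1 / 2) ^ n ∨ d x < |y x| ∨
        d x + j / 2 ^ K < |(x : ℝ) - ratOf c| := by
  classical
  let E : unitInterval → ℕ → Prop := fun x m =>
    (1 / 2 : ℝ) ^ m + (0 : ℕ) / 2 ^ 0 < |y x - ratOf 0| ∨
      (1 / 2 : ℝ) ^ m + j / 2 ^ K < |(x : ℝ) - ratOf c| ∨
      (1 / 2 : ℝ) ^ m + (1 : ℕ) / 2 ^ 1 < |(x : ℝ) - ratOf (fracCode 1 1)|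
  let S : unitInterval → ℕ → Prop := fun x m => E x m ∨ n ≤ m ∧ ∀ m', ¬ E x m'
  refine ⟨fun x => (1 / 2) ^ sInf {m | S x m}, ?_, fun x => by positivity,
    fun x => pow_le_one₀ (by norm_num) (by norm_num), fun x => ?_⟩
  · intro f hf
    rw [realOf_radius]
    have : ∀ m, Stops Y c K j n f m ↔ S ⟨realOf f, hf⟩ m := by
      intro m
      simp only [Stops, Escapes, Far, hY f hf, S, E]
    simp only [this]
  · have hS : ∃ m, S x m := by
      by_cases h : ∃ m, E x m
      · exact h.imp fun m hm => Or.inl hm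
      · exact ⟨n, Or.inr ⟨le_rfl, not_exists.1 h⟩⟩
    have hmem : S x (sInf {m | S x m}) := Nat.sInf_mem hS
    beta_reduce
    generalize sInf {m | S x m} = a at hmem
    rcases hmem with (h | h | h) | h
    · right; left
      simpa [ratOf] using h
    · exact Or.inr (Or.inr h)
    · exfalso
      have h0 := x.2.1
      have h1 := x.2.2
      have hp : (0 : ℝ) < (1 / 2) ^ a := by positivity
      have : |(x : ℝ) - ratOf (fracCode 1 1)| ≤ 1 / 2 := by
        rw [ratOf_fracCode, abs_le]
        push_cast
        constructor <;> linarith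
      push_cast at h
      linarith
    · left
      exact pow_le_pow_of_le_one (by norm_num) (by norm_num) h.1

theorem inside_iff {M : FunCode → (ℕ → ℕ)} (hM : IsPincherleRealiser M) {Y : FunCode}
    {y : unitInterval → unitInterval} (hY : Represents Y fun x => (y x : ℝ))
    (hball : ∀ x, 0 < (y x : ℝ) → ∀ z : unitInterval,
      (z : ℝ) ∈ Set.Ioo ((x : ℝ) - y x) ((x : ℝ) + y x) → 0 < (y z : ℝ)) (c K j : ℕ) :
    Inside (Y, M) c K j ↔
      ∀ z : unitInterval, |(z : ℝ) - ratOf c| ≤ j / 2 ^ K → 0 < (y z : ℝ) := by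
  constructor
  · intro h z hz
    by_contra hyz
    have hbound : ∀ n, realOf (M (radius Y c K j n)) ≤ 2 * (1 / 2) ^ n := by
      intro n
      obtain ⟨d, hd, hpos, hle, hcases⟩ := exists_represents_radius hY c K j n
      refine le_trans ((hM _ d hd hpos).2 (fun w => if w = z then 2 * (1 / 2) ^ n else 2) ?_ z)
        (by simp)
      intro x w hxw
      have hpn : (0 : ℝ) < (1 / 2) ^ n := by positivity
      split_ifs with hw
      · subst hw
        rcases hcases x with h1 | h1 | h1
        · linarith
        · exfalso
          rw [abs_of_nonneg (y x).2.1] at h1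
          have h2 := abs_lt.1 (hxw.trans h1)
          refine hyz (hball x ((hpos x).trans h1) w ⟨?_, ?_⟩) <;> linarith
        · exfalso
          have := abs_sub_le (x : ℝ) w (ratOf c)
          linarith
      · linarith [hle x]
    have hconst : ∀ n, M (radius Y c K j n) = M (radius Y c K j 0) := fun n =>
      funext fun k => h n k
    simp only [hconst] at hbound
    obtain ⟨d, hd, hpos, -⟩ := exists_represents_radius hY c K j 0
    have h0 := (hM _ d hd hpos).1
    obtain ⟨n, hn⟩ := exists_pow_lt_of_lt_one (half_pos h0) (by norm_num : (1 / 2 : ℝ) < 1)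
    linarith [hbound n]
  · intro h n k
    have hE : ∀ β, ∃ m, Escapes Y c K j β m := by
      intro β
      by_cases h1 : (j : ℝ) / 2 ^ K < |realOf β - ratOf c|
      · exact (exists_far h1).imp fun m hm => Or.inr (Or.inl hm)
      by_cases h2 : ((1 : ℕ) : ℝ) / 2 ^ 1 < |realOf β - ratOf (fracCode 1 1)|
      · exact (exists_far h2).imp fun m hm => Or.inr (Or.inr hm)
      have hβ : realOf β ∈ unitInterval := by
        rw [not_lt, ratOf_fracCode, abs_le] at h2
        push_cast at h2
        constructor <;> linarith [h2.1, h2.2]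
      have hy := h ⟨realOf β, hβ⟩ (not_lt.1 h1)
      refine (exists_far (c := 0) (K := 0) (j := 0) (g := Y β) ?_).imp fun m hm => Or.inl hm
      rw [hY β hβ]
      simpa [ratOf] using hy.ne'
    have hrad : radius Y c K j n = radius Y c K j 0 := by
      funext β k
      have : ∀ n m, Stops Y c K j n β m ↔ Escapes Y c K j β m := by
        intro n m
        obtain ⟨m', hm'⟩ := hE β
        exact ⟨fun hs => hs.resolve_right fun hs' => hs'.2 m' hm', Or.inl⟩
      simp only [radius, this]
    exact congrArg (fun R => M R k) hrad

theorem realOf_deltaOf {M : FunCode → (ℕ → ℕ)} (hM : IsPincherleRealiser M) {Y : FunCode}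
    {y : unitInterval → unitInterval} (hY : Represents Y fun x => (y x : ℝ))
    (hball : ∀ x, 0 < (y x : ℝ) → ∀ z : unitInterval,
      (z : ℝ) ∈ Set.Ioo ((x : ℝ) - y x) ((x : ℝ) + y x) → 0 < (y z : ℝ)) (f : ℕ → ℕ) {D : ℝ}
    (hD1 : D ≤ 1) (hlow : ∀ z : unitInterval, |(z : ℝ) - realOf f| < D → 0 < (y z : ℝ))
    (hup : D = 1 ∨ ∃ z : unitInterval, |(z : ℝ) - realOf f| = D ∧ ¬ 0 < (y z : ℝ)) :
    realOf (deltaOf (Y, M) f) = D := by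
  refine realOf_eq fun k => ?_
  set K := k + 3 with hK
  set c := hatCode f K with hc
  have hpos : (0 : ℝ) < 2 ^ K := by positivity
  have hcx : |(ratOf c : ℝ) - realOf f| ≤ 1 / 2 ^ K := by
    simpa using abs_hat_sub_realOf_le f K
  set t := count (fun j => Inside (Y, M) c K (j + 1)) (2 ^ K) with ht
  have h1 : ⌈D * 2 ^ K⌉₊ - 2 ≤ t := by
    refine le_count ?_ fun i hi => (inside_iff hM hY hball _ _ _).2 fun z hz => hlow z ?_
    · have : ⌈D * 2 ^ K⌉₊ ≤ 2 ^ K := Nat.ceil_le.2 (by push_cast; nlinarith)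
      omega
    · have hi2 : i + 2 < ⌈D * 2 ^ K⌉₊ := by omega
      have hi3 := Nat.lt_ceil.1 hi2
      have hi4 : ((i + 2 : ℕ) : ℝ) / 2 ^ K < D := (div_lt_iff₀ hpos).2 hi3
      have := abs_sub_le (z : ℝ) (ratOf c) (realOf f)
      have h5 : ((i + 2 : ℕ) : ℝ) / 2 ^ K = ((i + 1 : ℕ) : ℝ) / 2 ^ K + 1 / 2 ^ K := by
        push_cast; ring
      linarith
  have h2 : (t : ℝ) ≤ D * 2 ^ K + 1 := by
    rcases hup with rfl | ⟨z, hz, hyz⟩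
    · have : (t : ℝ) ≤ 2 ^ K := by exact_mod_cast count_le_self _ _
      linarith
    · have hD0 : 0 ≤ D := hz ▸ abs_nonneg _
      have : t ≤ ⌈D * 2 ^ K⌉₊ := by
        refine count_le _ fun i hi hin => hyz ((inside_iff hM hY hball _ _ _).1 hin z ?_)
        have hi' : D ≤ i / 2 ^ K := (le_div_iff₀ hpos).2 (Nat.ceil_le.1 hi)
        have h3 := abs_sub_le (z : ℝ) (realOf f) (ratOf c)
        rw [abs_sub_comm (realOf f)] at h3
        have h5 : ((i + 1 : ℕ) : ℝ) / 2 ^ K = (i : ℝ) / 2 ^ K + 1 / 2 ^ K := by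
          push_cast; ring
        linarith
      have h4 := Nat.ceil_lt_add_one (a := D * 2 ^ K) (by positivity)
      have h5 : (t : ℝ) ≤ ⌈D * 2 ^ K⌉₊ := by exact_mod_cast this
      linarith
  have h3 : D * 2 ^ K ≤ t + 2 := by
    have : ⌈D * 2 ^ K⌉₊ ≤ t + 2 := by omega
    exact_mod_cast (Nat.le_ceil _).trans (by exact_mod_cast this)
  have h4 : deltaOf (Y, M) f k = fracCode t K := rfl
  rw [h4, ratOf_fracCode]
  push_cast
  have h5 : (1 / 2 : ℝ) ^ (k + 2) = 2 / 2 ^ K := by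
    rw [hK, pow_succ _ (k + 2), one_div_pow]
    field_simp
  have h6 : (t : ℝ) / 2 ^ K - D = (t - D * 2 ^ K) / 2 ^ K := by field_simp
  rw [h5, h6, abs_div, abs_of_pos hpos]
  refine div_le_div_of_nonneg_right ?_ hpos.le
  rw [abs_le]
  constructor <;> linarith

theorem isDelta_deltaOf {M : FunCode → (ℕ → ℕ)} (hM : IsPincherleRealiser M) :
    IsDelta fun Y f k => deltaOf (Y, M) f k := by
  classical
  rintro Y O hO ⟨y, hY, rfl, hball⟩
  by_cases hne : ({x | 0 < (y x : ℝ)} : Set unitInterval)ᶜ.Nonempty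
  · refine ⟨fun x => Metric.infDist x {x | 0 < (y x : ℝ)}ᶜ, ?_, Metric.continuous_infDist_pt _,
      fun _ _ => rfl, fun h => ?_⟩
    · intro f hf
      obtain ⟨z, hz, hdz⟩ := hO.isClosed_compl.isCompact.exists_infDist_eq_dist hne
        (⟨realOf f, hf⟩ : unitInterval)
      rw [dist_comm, Subtype.dist_eq, Real.dist_eq] at hdz
      refine realOf_deltaOf hM hY hball f ?_ (fun w hw => ?_) (Or.inr ⟨z, hdz.symm, hz⟩)
      · beta_reduce
        rw [hdz, abs_le]
        have := z.2.1
        have := z.2.2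
        have := hf.1
        have := hf.2
        constructor <;> simp only [] <;> linarith
      · by_contra hyw
        have h1 := Metric.infDist_le_dist_of_mem (x := (⟨realOf f, hf⟩ : unitInterval))
          (s := {x | 0 < (y x : ℝ)}ᶜ) (y := w) hyw
        rw [dist_comm, Subtype.dist_eq, Real.dist_eq] at h1
        linarith
    · rw [h] at hne
      simp at hne
  · have hall : ∀ z, 0 < (y z : ℝ) := fun z => by
      by_contra hz
      exact hne ⟨z, hz⟩
    refine ⟨fun _ => 1, ?_, continuous_const, fun h => absurd h hne, fun _ _ => rfl⟩
    exact fun f hf => realOf_deltaOf hM hY hball f le_rfl (fun z _ => hall z) (Or.inl rfl)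

theorem exists_index_deltaOf : ∃ e : ℕ, ∀ (M : FunCode → (ℕ → ℕ)) (Y : FunCode) (f : ℕ → ℕ)
    (k : ℕ), ComputesAt e [arg2 existsTwo, arg3 (pure3 M)]
      (fun Y f k => deltaOf (Y, M) f k) Y f k := by
  obtain ⟨e, he⟩ := comp_deltaOf
  exact ⟨e, fun M Y f k => he k f (Y, M)⟩

/-! ### Computations have at most one value -/

theorem idx_inj {s a b s' a' b' : ℕ} : idx s a b = idx s' a' b' ↔ s = s' ∧ a = a' ∧ b = b' := by
  simp [idx, Nat.pair_eq_pair]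

theorem arg0_inj {x y : ℕ} : arg0 x = arg0 y ↔ x = y :=
  ⟨fun h => eq_of_heq (Sigma.mk.inj h).2, congrArg _⟩

theorem arg1_inj {f g : ℕ → ℕ} : arg1 f = arg1 g ↔ f = g :=
  ⟨fun h => eq_of_heq (Sigma.mk.inj h).2, congrArg _⟩

theorem Kleene.unique {e : ℕ} {l : List Arg} {m : ℕ} (h : Kleene e l m) :
    ∀ {m' : ℕ}, Kleene e l m' → m = m' := by
  induction h with
  | s1 x l =>
    intro m' h'
    generalize he : idx 1 0 0 = e at h'
    generalize hl : arg0 x :: l = L at h'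
    cases h' <;> simp [idx_inj] at he
    simp only [List.cons.injEq, arg0_inj] at hl
    obtain ⟨rfl, -⟩ := hl
    rfl
  | s2 q l =>
    intro m' h'
    generalize he : idx 2 q 0 = e at h'
    cases h' <;> simp [idx_inj] at he
    exact he
  | s3 x l =>
    intro m' h'
    generalize he : idx 3 0 0 = e at h'
    generalize hl : arg0 x :: l = L at h'
    cases h' <;> simp [idx_inj] at he
    simp only [List.cons.injEq, arg0_inj] at hl
    exact hl.1
  | @s4 g h l n m h1 h2 ih1 ih2 =>
    intro m' h'
    generalize he : idx 4 g h = e at h'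
    cases h' <;> simp [idx_inj] at he
    obtain ⟨rfl, rfl⟩ := he
    rename_i k2 k1
    obtain rfl := ih1 k1
    exact ih2 k2
  | @s5_zero g h l m h1 ih =>
    intro m' h'
    generalize he : idx 5 g h = e at h'
    generalize hl : arg0 0 :: l = L at h'
    cases h' <;> simp [idx_inj] at he <;>
      simp [arg0_inj] at hl
    obtain ⟨rfl, rfl⟩ := he
    obtain rfl := hl
    exact ih ‹_›
  | @s5_succ g h x l n m h1 h2 ih1 ih2 =>
    intro m' h'
    generalize he : idx 5 g h = e at h'
    generalize hl : arg0 (x + 1) :: l = L at h'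
    cases h' <;> simp [idx_inj] at he <;>
      simp [arg0_inj] at hl
    obtain ⟨rfl, rfl⟩ := he
    obtain ⟨rfl, rfl⟩ := hl
    rename_i k2 k1
    obtain rfl := ih1 k1
    exact ih2 k2
  | @s6 g a l₁ l₂ m h1 ih =>
    intro m' h'
    generalize he : idx 6 l₁.length g = e at h'
    generalize hl : l₁ ++ a :: l₂ = L at h'
    cases h' <;> simp [idx_inj] at he
    obtain ⟨hlen, rfl⟩ := he
    obtain ⟨rfl, hl'⟩ := List.append_inj hl hlen
    obtain ⟨rfl, rfl⟩ := List.cons.inj hl'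
    exact ih ‹_›
  | s7 f x l =>
    intro m' h'
    generalize he : idx 7 0 0 = e at h'
    generalize hl : arg1 f :: arg0 x :: l = L at h'
    cases h' <;> simp [idx_inj] at he
    simp only [List.cons.injEq, arg0_inj, arg1_inj] at hl
    rw [hl.1, hl.2.1]
  | @s8 g j α l G h1 ih =>
    intro m' h'
    generalize he : idx 8 j g = e at h'
    generalize hl : (⟨j + 2, α⟩ :: l : List Arg) = L at h'
    cases h' <;> simp [idx_inj] at he
    obtain ⟨rfl, rfl⟩ := he
    simp only [List.cons.injEq, Sigma.mk.injEq, heq_eq_eq, true_and] at hl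
    obtain ⟨rfl, rfl⟩ := hl
    rename_i G' h2
    exact congrArg α (funext fun β => ih β (h2 β))
  | @s9 a l₁ l₂ m h1 ih =>
    intro m' h'
    generalize he : idx 9 l₁.length 0 = e at h'
    generalize hl : arg0 a :: (l₁ ++ l₂) = L at h'
    cases h' <;> simp [idx_inj] at he
    simp only [List.cons.injEq, arg0_inj] at hl
    obtain ⟨rfl, hl⟩ := hl
    obtain ⟨rfl, rfl⟩ := List.append_inj hl he
    exact ih ‹_›

/-! ### Radius functions given by labels -/

/-- The code of the radius with label `n`; the label 0 stands for the radius 0. -/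
def labelCode (n : ℕ) : ℕ := if n = 0 then fracCode 0 0 else fracCode 1 (n + 3)

/-- The radius with label `n`. -/
noncomputable def labelVal (n : ℕ) : ℝ := if n = 0 then 0 else (1 / 2) ^ (n + 3)

theorem labelVal_nonneg (n : ℕ) : 0 ≤ labelVal n := by
  unfold labelVal; split_ifs <;> positivity

theorem labelVal_le_one (n : ℕ) : labelVal n ≤ 1 := by
  unfold labelVal
  split_ifs
  · norm_num
  · exact pow_le_one₀ (by norm_num) (by norm_num)

theorem labelVal_pos_iff {n : ℕ} : 0 < labelVal n ↔ n ≠ 0 := by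
  unfold labelVal
  split_ifs with h
  · simp [h]
  · simp [h]

theorem ratOf_labelCode (n : ℕ) : (ratOf (labelCode n) : ℝ) = labelVal n := by
  unfold labelCode labelVal
  split_ifs <;> simp [ratOf_fracCode]

/-- The type `1 → 1` object whose value at a representation of `x` represents the radius with
label `c x`. -/
noncomputable def ofLabels (c : ℝ → ℕ) : FunCode := fun f _ => labelCode (c (realOf f))

theorem realOf_ofLabels (c : ℝ → ℕ) (f : ℕ → ℕ) :
    realOf (ofLabels c f) = labelVal (c (realOf f)) :=
  realOf_eq fun k => by simp [ofLabels, ratOf_labelCode]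

theorem radiusRep_ofLabels (c : ℝ → ℕ) {O : Set unitInterval} (hO : ∀ x, x ∈ O ↔ c x ≠ 0)
    (hball : ∀ x ∈ O, ∀ z : unitInterval, |(z : ℝ) - x| < labelVal (c x) → z ∈ O) :
    RadiusRep (ofLabels c) O := by
  refine ⟨fun x => ⟨labelVal (c x), labelVal_nonneg _, labelVal_le_one _⟩,
    fun f _ => realOf_ofLabels c f, ?_, fun x hx z hz => ?_⟩
  · ext x
    rw [hO]
    exact labelVal_pos_iff.symm
  · refine hball x ((hO x).2 (labelVal_pos_iff.1 hx)) z (abs_lt.2 ?_)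
    have h1 := hz.1
    have h2 := hz.2
    simp only at h1 h2
    constructor <;> linarith

/-! ### Labellings that are closed under computations -/

/-- The labelling `c'` extends the labelling `c`; the label 0 means undefined. -/
def Extends (c c' : ℝ → ℕ) : Prop := ∀ x, c x ≠ 0 → c' x = c x

theorem Extends.refl (c : ℝ → ℕ) : Extends c c := fun _ _ => rfl

theorem Extends.trans {a b c : ℝ → ℕ} (hab : Extends a b) (hbc : Extends b c) : Extends a c :=
  fun x hx => by rw [hbc x (by rwa [hab x hx]), hab x hx]

/-- The argument with code `t`: one of three fixed ones, or a number. -/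
def argOf (F : (ℕ → ℕ) → ℕ) (f : ℕ → ℕ) (Y : FunCode) : ℕ → Arg
  | 0 => arg2 F
  | 1 => arg2 (pure2 Y)
  | 2 => arg1 f
  | n + 3 => arg0 n

/-- The computation with index `e` and the arguments coded by `l` has the value `m`, for every
extension of the labelling `c`. -/
def Forced (F : (ℕ → ℕ) → ℕ) (f : ℕ → ℕ) (c : ℝ → ℕ) (e : ℕ) (l : List ℕ) (m : ℕ) : Prop :=
  ∀ c', Extends c c' → Kleene e (l.map (argOf F f (ofLabels c'))) m

theorem Forced.mono {F : (ℕ → ℕ) → ℕ} {f : ℕ → ℕ} {c c' : ℝ → ℕ} {e : ℕ} {l : List ℕ} {m : ℕ}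
    (h : Forced F f c e l m) (hc : Extends c c') : Forced F f c' e l m :=
  fun c'' h'' => h c'' (hc.trans h'')

/-- The labelling `c` forces the functional with index `g` and parameters `l` to have the value
`h`. -/
def ForcedFun (F : (ℕ → ℕ) → ℕ) (f : ℕ → ℕ) (c : ℝ → ℕ) (g : ℕ) (l : List ℕ) (h : ℕ → ℕ) :
    Prop :=
  ∀ k, Forced F f c g (1 :: (k + 3) :: l) (h k)

/-- The label `n` describes a computation of the real `x`. -/
def Names (F : (ℕ → ℕ) → ℕ) (f : ℕ → ℕ) (c : ℝ → ℕ) (n : ℕ) (x : ℝ) : Prop :=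
  ∃ g l h, n = Nat.pair g (Encodable.encode l) + 1 ∧ ForcedFun F f c g l h ∧
    realOf (fun i => h (i + 1)) = x

theorem Names.mono {F : (ℕ → ℕ) → ℕ} {f : ℕ → ℕ} {c c' : ℝ → ℕ} {n : ℕ} {x : ℝ}
    (h : Names F f c n x) (hc : Extends c c') : Names F f c' n x := by
  obtain ⟨g, l, h, hn, hh, hx⟩ := h
  exact ⟨g, l, h, hn, fun k => (hh k).mono hc, hx⟩

theorem Names.unique {F : (ℕ → ℕ) → ℕ} {f : ℕ → ℕ} {c : ℝ → ℕ} {n : ℕ} {x x' : ℝ}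
    (h : Names F f c n x) (h' : Names F f c n x') : x = x' := by
  obtain ⟨g, l, h, rfl, hh, rfl⟩ := h
  obtain ⟨g', l', h', hn, hh', rfl⟩ := h'
  rw [Nat.add_right_cancel_iff, Nat.pair_eq_pair] at hn
  obtain ⟨rfl, hl⟩ := hn
  obtain rfl := Encodable.encode_injective hl
  have : h = h' := funext fun k =>
    (hh k c (Extends.refl c)).unique (hh' k c (Extends.refl c))
  rw [this]

/-- Every label describes a computation of the labelled real. -/
def Sound (F : (ℕ → ℕ) → ℕ) (f : ℕ → ℕ) (c : ℝ → ℕ) : Prop := ∀ x, c x ≠ 0 → Names F f c (c x) x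

/-- Every real whose computation is forced has a label. -/
def Closed (F : (ℕ → ℕ) → ℕ) (f : ℕ → ℕ) (c : ℝ → ℕ) : Prop :=
  ∀ g l h, ForcedFun F f c g l h → c (realOf fun i => h (i + 1)) ≠ 0

theorem exists_sound_closed (F : (ℕ → ℕ) → ℕ) (f : ℕ → ℕ) :
    ∃ c, Sound F f c ∧ Closed F f c := by
  classical
  obtain ⟨⟨c, hc⟩, hmax⟩ := exists_maximal_of_chains_bounded
    (r := fun a b : {c // Sound F f c} => Extends a.1 b.1) (fun C hC => by
      let u : ℝ → ℕ := fun x => if h : ∃ a ∈ C, a.1 x ≠ 0 then h.choose.1 x else 0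
      have hu : ∀ a ∈ C, Extends a.1 u := by
        intro a ha x hx
        have h : ∃ a ∈ C, a.1 x ≠ 0 := ⟨a, ha, hx⟩
        have hux : u x = h.choose.1 x := dif_pos h
        rw [hux]
        rcases eq_or_ne a h.choose with heq | hne
        · rw [← heq]
        · rcases hC ha h.choose_spec.1 hne with h1 | h1
          · exact h1 x hx
          · exact (h1 x h.choose_spec.2).symm
      refine ⟨⟨u, fun x hx => ?_⟩, fun a ha => hu a ha⟩
      by_cases h : ∃ a ∈ C, a.1 x ≠ 0
      · obtain ⟨a, ha, hax⟩ := h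
        rw [hu a ha x hax]
        exact (a.2 x hax).mono (hu a ha)
      · exact absurd (dif_neg h) hx) (fun h1 h2 => h1.trans h2)
  refine ⟨c, hc, fun g l h hh hx => ?_⟩
  set x := realOf fun i => h (i + 1) with hxdef
  let c' : ℝ → ℕ := Function.update c x (Nat.pair g (Encodable.encode l) + 1)
  have hc'x : c' x = Nat.pair g (Encodable.encode l) + 1 := Function.update_self ..
  have hext : Extends c c' := fun z hz =>
    Function.update_of_ne (by rintro rfl; exact hz hx) _ _
  have hs : Sound F f c' := by
    intro z hz
    rcases eq_or_ne z x with rfl | hne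
    · exact Names.mono ⟨g, l, h, hc'x, hh, rfl⟩ hext
    · have : c' z = c z := Function.update_of_ne hne _ _
      rw [this] at hz ⊢
      exact (hc z hz).mono hext
  have := hmax ⟨c', hs⟩ hext x (by simp [hc'x])
  simp only [hx, hc'x] at this
  omega

theorem argOf_eq_arg0 {F : (ℕ → ℕ) → ℕ} {f : ℕ → ℕ} {Y : FunCode} {t x : ℕ}
    (h : argOf F f Y t = arg0 x) : t = x + 3 := by
  rcases t with _ | _ | _ | t
  · exact absurd (congrArg Sigma.fst h) (by simp [argOf, arg0, arg2])
  · exact absurd (congrArg Sigma.fst h) (by simp [argOf, arg0, arg2])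
  · exact absurd (congrArg Sigma.fst h) (by simp [argOf, arg0, arg1])
  · exact congrArg (· + 3) (arg0_inj.1 h)

theorem argOf_eq_arg1 {F : (ℕ → ℕ) → ℕ} {f f' : ℕ → ℕ} {Y : FunCode} {t : ℕ}
    (h : argOf F f Y t = arg1 f') : t = 2 ∧ f = f' := by
  rcases t with _ | _ | _ | t
  · exact absurd (congrArg Sigma.fst h) (by simp [argOf, arg1, arg2])
  · exact absurd (congrArg Sigma.fst h) (by simp [argOf, arg1, arg2])
  · exact ⟨rfl, arg1_inj.1 h⟩
  · exact absurd (congrArg Sigma.fst h) (by simp [argOf, arg1, arg0])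

/-- A computation with values of a closed labelling depends on this labelling only. -/
theorem Kleene.forced {F : (ℕ → ℕ) → ℕ} {f : ℕ → ℕ} {c : ℝ → ℕ} (hc : Closed F f c)
    {c' : ℝ → ℕ} (hc' : Extends c c') {e : ℕ} {L : List Arg} {m : ℕ} (h : Kleene e L m) :
    ∀ l : List ℕ, l.map (argOf F f (ofLabels c')) = L → Forced F f c e l m := by
  induction h with
  | s1 x L =>
    intro l hl c'' _
    obtain ⟨t, l, rfl, ht, rfl⟩ := List.map_eq_cons_iff.1 hl
    obtain rfl := argOf_eq_arg0 ht
    exact Kleene.s1 x _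
  | s2 q L => exact fun l _ c'' _ => Kleene.s2 q _
  | s3 x L =>
    intro l hl c'' _
    obtain ⟨t, l, rfl, ht, rfl⟩ := List.map_eq_cons_iff.1 hl
    obtain rfl := argOf_eq_arg0 ht
    exact Kleene.s3 x _
  | @s4 g h L n m _ _ ih1 ih2 =>
    intro l hl c'' h''
    exact Kleene.s4 (ih1 l hl c'' h'') (ih2 ((n + 3) :: l) (by rw [← hl]; rfl) c'' h'')
  | s5_zero _ ih =>
    intro l hl c'' h''
    obtain ⟨t, l, rfl, ht, rfl⟩ := List.map_eq_cons_iff.1 hl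
    obtain rfl := argOf_eq_arg0 ht
    exact Kleene.s5_zero (ih l rfl c'' h'')
  | @s5_succ g h x L n m _ _ ih1 ih2 =>
    intro l hl c'' h''
    obtain ⟨t, l, rfl, ht, rfl⟩ := List.map_eq_cons_iff.1 hl
    obtain rfl := argOf_eq_arg0 ht
    exact Kleene.s5_succ (ih1 ((x + 3) :: l) rfl c'' h'')
      (ih2 ((x + 3) :: (n + 3) :: l) rfl c'' h'')
  | s6 _ ih =>
    intro l hl c'' h''
    obtain ⟨l₁, l', rfl, rfl, hl'⟩ := List.map_eq_append_iff.1 hl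
    obtain ⟨t, l₂, rfl, rfl, rfl⟩ := List.map_eq_cons_iff.1 hl'
    have := ih (t :: (l₁ ++ l₂)) (by simp) c'' h''
    rw [List.map_cons, List.map_append] at this
    have := Kleene.s6 this
    simpa using this
  | s7 f' x L =>
    intro l hl c'' _
    obtain ⟨t, l', rfl, ht, hl'⟩ := List.map_eq_cons_iff.1 hl
    obtain ⟨s, l, rfl, hs, rfl⟩ := List.map_eq_cons_iff.1 hl'
    obtain rfl := argOf_eq_arg0 hs
    obtain ⟨rfl, rfl⟩ := argOf_eq_arg1 ht
    exact Kleene.s7 f x _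
  | @s8 g j α L G _ ih =>
    intro l hl
    obtain ⟨t, l, rfl, ht, rfl⟩ := List.map_eq_cons_iff.1 hl
    rcases t with _ | _ | _ | t
    · cases ht
      intro c'' h''
      exact Kleene.s8 (j := 0) F fun (k : ℕ) => ih k (0 :: (k + 3) :: l) rfl c'' h''
    · cases ht
      have hG : ForcedFun F f c g l G := fun (k : ℕ) => ih k (1 :: (k + 3) :: l) rfl
      have hx := hc g l G hG
      intro c'' h''
      have := Kleene.s8 (j := 0) (pure2 (ofLabels c'')) fun k => hG k c'' h''
      have heq : pure2 (ofLabels c') G = pure2 (ofLabels c'') G := by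
        simp only [pure2, ofLabels]
        rw [hc' _ hx, h'' _ hx]
      rw [heq]
      exact this
    · exact absurd (congrArg Sigma.fst ht) (by simp [argOf, arg1])
    · exact absurd (congrArg Sigma.fst ht) (by simp [argOf, arg0])
  | s9 _ ih =>
    intro l hl c'' h''
    obtain ⟨t, l', rfl, ht, hl'⟩ := List.map_eq_cons_iff.1 hl
    obtain ⟨l₁, l₂, rfl, rfl, rfl⟩ := List.map_eq_append_iff.1 hl'
    obtain rfl := argOf_eq_arg0 ht
    have := Kleene.s9 (l₂ := l₂.map (argOf F f (ofLabels c''))) (ih l₁ rfl c'' h'')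
    simpa [argOf] using this

/-! ### The labelled balls do not cover the unit interval -/

/-- The union of the labelled balls. -/
def balls (c : ℝ → ℕ) : Set ℝ := {z | ∃ x, c x ≠ 0 ∧ |z - x| < labelVal (c x)}

theorem isOpen_balls (c : ℝ → ℕ) : IsOpen (balls c) := by
  have : balls c = ⋃ x, ⋃ _ : c x ≠ 0, Metric.ball x (labelVal (c x)) := by
    ext z
    simp [balls, Real.dist_eq]
  rw [this]
  exact isOpen_iUnion fun x => isOpen_iUnion fun _ => Metric.isOpen_ball

theorem volume_balls_lt_one {c : ℝ → ℕ} (hc : ∀ x x', c x ≠ 0 → c x = c x' → x = x') :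
    MeasureTheory.volume (balls c) < 1 := by
  let B : ℕ → Set ℝ := fun n => {z | ∃ x, c x = n ∧ n ≠ 0 ∧ |z - x| < labelVal n}
  have hB : balls c ⊆ ⋃ n, B n := fun z ⟨x, hx, hz⟩ => Set.mem_iUnion.2 ⟨c x, x, rfl, hx, hz⟩
  have hvol : ∀ n, MeasureTheory.volume (B n) ≤ ENNReal.ofReal ((1 / 4) * (1 / 2) ^ n) := by
    intro n
    by_cases h : ∃ x, c x = n ∧ n ≠ 0
    · obtain ⟨x, rfl, hx⟩ := h
      have hsub : B (c x) ⊆ Metric.ball x (labelVal (c x)) := by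
        rintro z ⟨x', h1, -, h2⟩
        obtain rfl := hc x x' hx h1.symm
        simpa [Real.dist_eq] using h2
      refine (MeasureTheory.measure_mono hsub).trans ?_
      rw [Real.volume_ball]
      refine ENNReal.ofReal_le_ofReal (le_of_eq ?_)
      rw [labelVal, if_neg hx]
      ring
    · have : B n = ∅ := by
        ext z
        simp only [B, Set.mem_ofPred_eq, Set.mem_empty_iff_false, iff_false]
        rintro ⟨x, h1, h2, -⟩
        exact h ⟨x, h1, h2⟩
      simp [this]
  have hsum : Summable fun n : ℕ => (1 / 4 : ℝ) * (1 / 2) ^ n :=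
    summable_geometric_two.mul_left _
  calc MeasureTheory.volume (balls c) ≤ ∑' n, MeasureTheory.volume (B n) :=
        (MeasureTheory.measure_mono hB).trans (MeasureTheory.measure_iUnion_le _)
    _ ≤ ∑' n, ENNReal.ofReal ((1 / 4) * (1 / 2) ^ n) := ENNReal.tsum_le_tsum hvol
    _ = ENNReal.ofReal (∑' n, (1 / 4) * (1 / 2) ^ n) :=
        (ENNReal.ofReal_tsum_of_nonneg (fun n => by positivity) hsum).symm
    _ < 1 := by
        rw [tsum_mul_left, tsum_geometric_two, ENNReal.ofReal_lt_one]
        norm_num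

theorem exists_notMem_balls {c : ℝ → ℕ} (hc : ∀ x x', c x ≠ 0 → c x = c x' → x = x') :
    ∃ z ∈ Set.Ico (0 : ℝ) 1, z ∉ balls c := by
  by_contra! h
  have := (MeasureTheory.measure_mono (μ := MeasureTheory.volume) h).trans_lt
    (volume_balls_lt_one hc)
  simp at this

/-- Every labelling `c` extends to one that is positive exactly on the union of the balls of `c` and
whose balls are subsets of this union. -/
theorem exists_extends_balls (c : ℝ → ℕ) : ∃ c', Extends c c' ∧ (∀ x, x ∈ balls c ↔ c' x ≠ 0) ∧
    ∀ x ∈ balls c, ∀ z, |z - x| < labelVal (c' x) → z ∈ balls c := by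
  have h : ∀ x, ∃ n, (c x ≠ 0 → n = c x) ∧ (x ∈ balls c ↔ n ≠ 0) ∧
      ∀ z, |z - x| < labelVal n → z ∈ balls c := by
    intro x
    by_cases hx : c x = 0
    · by_cases hb : x ∈ balls c
      · obtain ⟨ε, hε, hball⟩ := Metric.isOpen_iff.1 (isOpen_balls c) x hb
        obtain ⟨n, hn⟩ := exists_pow_lt_of_lt_one hε (by norm_num : (1 / 2 : ℝ) < 1)
        refine ⟨n + 1, fun h => absurd hx h, by simpa using hb, fun z hz => hball ?_⟩
        rw [labelVal, if_neg (Nat.succ_ne_zero n)] at hz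
        have : (1 / 2 : ℝ) ^ (n + 1 + 3) ≤ (1 / 2) ^ n :=
          pow_le_pow_of_le_one (by norm_num) (by norm_num) (by omega)
        rw [Metric.mem_ball, Real.dist_eq]
        linarith
      · refine ⟨0, fun h => absurd hx h, by simpa using hb, fun z hz => ?_⟩
        simp only [labelVal, if_true] at hz
        exact absurd hz (not_lt.2 (abs_nonneg _))
    · refine ⟨c x, fun _ => rfl, iff_of_true ⟨x, hx, ?_⟩ hx, fun z hz => ⟨x, hx, hz⟩⟩
      simpa using labelVal_pos_iff.2 hx
  choose c' h1 h2 h3 using h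
  exact ⟨c', h1, h2, fun x _ => h3 x⟩

theorem not_computes_delta (F : (ℕ → ℕ) → ℕ) {Δ : FunCode → FunCode} (hΔ : IsDelta Δ) :
    ¬ ∃ e : ℕ, ∀ (Y : FunCode) (O : Set unitInterval), IsOpen O → RadiusRep Y O →
      ∀ f : ℕ → ℕ, realOf f ∈ unitInterval → ∀ k : ℕ, ComputesAt e [arg2 F] Δ Y f k := by
  classical
  rintro ⟨e, he⟩
  let f : ℕ → ℕ := fun _ => fracCode 0 0
  have hf : realOf f = 0 := realOf_eq fun k => by simp [f, ratOf_fracCode]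
  have hf01 : realOf f ∈ unitInterval := by rw [hf]; exact unitInterval.zero_mem
  obtain ⟨c, hs, hc⟩ := exists_sound_closed F f
  have hinj : ∀ x x', c x ≠ 0 → c x = c x' → x = x' := fun x x' hx hxx' =>
    (hs x hx).unique (by rw [hxx']; exact hs x' (hxx' ▸ hx))
  obtain ⟨c₂, hc₂, hpos₂, hball₂⟩ := exists_extends_balls c
  let c₁ : ℝ → ℕ := fun x => if c x = 0 then 1 else c x
  have hc₁ : Extends c c₁ := fun x hx => if_neg hx
  have hpos₁ : ∀ x, c₁ x ≠ 0 := fun x => by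
    simp only [c₁]
    split_ifs with h
    · exact one_ne_zero
    · exact h
  let O : Set unitInterval := {x | (x : ℝ) ∈ balls c}
  have hO : IsOpen O := (isOpen_balls c).preimage continuous_subtype_val
  have hR₁ : RadiusRep (ofLabels c₁) Set.univ :=
    radiusRep_ofLabels c₁ (fun x => by simp [hpos₁]) (fun _ _ _ _ => trivial)
  have hR₂ : RadiusRep (ofLabels c₂) O :=
    radiusRep_ofLabels c₂ (fun x => hpos₂ x) (fun x hx z hz => hball₂ x hx z hz)
  have heq : Δ (ofLabels c₁) f = Δ (ofLabels c₂) f := by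
    funext k
    have h1 := Kleene.forced hc hc₁ (he _ _ isOpen_univ hR₁ f hf01 k) [k + 3, 2, 1, 0] rfl
    exact (h1 c₂ hc₂).unique (he _ _ hO hR₂ f hf01 k)
  obtain ⟨d₁, hd₁, -, -, h₁⟩ := hΔ _ _ isOpen_univ hR₁
  obtain ⟨d₂, hd₂, -, h₂, -⟩ := hΔ _ _ hO hR₂
  obtain ⟨z, ⟨hz0, hz1⟩, hz⟩ := exists_notMem_balls hinj
  have hzO : (⟨z, hz0, hz1.le⟩ : unitInterval) ∈ Oᶜ := hz
  have h3 : Metric.infDist (⟨realOf f, hf01⟩ : unitInterval) Oᶜ = 1 := by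
    rw [← h₂ ⟨_, hzO⟩, ← hd₂ f hf01, ← heq, hd₁ f hf01, h₁ rfl]
  have h4 := Metric.infDist_le_dist_of_mem (x := (⟨realOf f, hf01⟩ : unitInterval)) hzO
  rw [h3, dist_comm, Subtype.dist_eq, Real.dist_eq] at h4
  simp only [hf, sub_zero, abs_of_nonneg hz0] at h4
  linarith

end KleeneHigher

theorem theorem7p5 :
    (∃ e : ℕ, ∀ M : KleeneHigher.FunCode → (ℕ → ℕ), KleeneHigher.IsPincherleRealiser M →
      ∃ Δ : KleeneHigher.FunCode → KleeneHigher.FunCode, KleeneHigher.IsDelta Δ ∧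
        ∀ (Y : KleeneHigher.FunCode) (f : ℕ → ℕ) (k : ℕ),
          KleeneHigher.ComputesAt e
            [KleeneHigher.arg2 KleeneHigher.existsTwo,
              KleeneHigher.arg3 (KleeneHigher.pure3 M)] Δ Y f k) ∧
    (∀ (F : (ℕ → ℕ) → ℕ) (Δ : KleeneHigher.FunCode → KleeneHigher.FunCode),
      KleeneHigher.IsDelta Δ →
      ¬ ∃ e : ℕ, ∀ (Y : KleeneHigher.FunCode) (O : Set unitInterval),
        IsOpen O → KleeneHigher.RadiusRep Y O →
        ∀ f : ℕ → ℕ, KleeneHigher.realOf f ∈ unitInterval →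
        ∀ k : ℕ, KleeneHigher.ComputesAt e [KleeneHigher.arg2 F] Δ Y f k) := by
  refine ⟨?_, fun F Δ hΔ => KleeneHigher.not_computes_delta F hΔ⟩
  obtain ⟨e, he⟩ := KleeneHigher.exists_index_deltaOf
  exact ⟨e, fun M hM => ⟨_, KleeneHigher.isDelta_deltaOf hM, he M⟩⟩
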